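/- Fix a constant $0<\alpha<1$. Consider synchronous deterministic message passing on the complete graph $K_n$ ($n\ge 2$) with a chordal sense of direction: there is a fixed Hamiltonian cycle, unknown to the vertices, and at every vertex the link to another vertex is labelled by the clockwise distance to that vertex along the cycle. All vertices start simultaneously, run the same protocol (which may depend on $n$ and $\alpha$), and know at the start only whether they are the initiator. In each step every vertex may send an arbitrary message over each of its links, possibly different ones over different links; messages that are not lost are delivered before the next step, and senders are not told whether a message was delivered. Messages are lost according to the fractional dynamic faults model with threshold: in a step in which $m$ messages are sent, an adversary may destroy any of them, up to $$\max\{c(K_n)-1,\lfloor \alpha m\rfloor\}$$ in number, where $c(K_n)=n-1$ is the edge connectivity. At the start only the initiator has the piece of information to be broadcast, and a vertex obtains it when it receives a message from a vertex that has it. Then complete broadcasting is possible in time $O(\log n)$: there is a constant $C$, depending only on $\alpha$, such that for every $n\ge 2$ there are a number $T\le C\log n$ and a protocol such that, for every Hamiltonian cycle defining the labels, every initiator and every behaviour of the adversary, all $n$ vertices have the information after $T$ steps. -/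

import Mathlib

namespace FaultyBroadcast

/-- The edge connectivity `c(G)`: the largest `k` such that removing fewer than `k` edges never
disconnects the graph. -/
noncomputable def edgeConnectivity {V : Type} (G : SimpleGraph V) : ℕ :=
  sSup {k : ℕ | G.IsEdgeConnected k}

/-- A network whose arcs carry local labels: `label u v` is the label by which the vertex `u` knows
its link to `v` (it is meaningful only for adjacent `u`, `v`). -/
structure Network (V Λ : Type) where
  graph : SimpleGraph V
  label : V → V → Λ

/-- The complete graph on `V` with the chordal sense of direction given by the Hamiltonian cycle
`cyc 0, cyc 1, …, cyc (n - 1), cyc 0`: at every vertex `u` the link to `v ≠ u` is labelled by the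
clockwise distance from `u` to `v` along the cycle. The label `0` belongs to no link. -/
def chordalComplete {n : ℕ} {V : Type} (cyc : ZMod n ≃ V) : Network V (ZMod n) where
  graph := ⊤
  label u v := cyc.symm v - cyc.symm u

/-- A deterministic synchronous protocol, executed by all vertices alike. A vertex is in the state
`initiatorState` or `otherState` at the start. In each step a vertex in state `q` sends the message
`send q ℓ` over its link with label `ℓ` (nothing if this is `none`), and it then passes to the state
`receive q I`, where `I` is the set of pairs `(ℓ, m)` such that the message `m` has just been
delivered to it over its link with label `ℓ`. There are no acknowledgements, so a vertex sees only
its own state and the messages delivered to it. Messages and local computation are unrestricted. -/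
structure Protocol (Λ : Type) where
  State : Type
  Msg : Type
  initiatorState : State
  otherState : State
  send : State → Λ → Option Msg
  receive : State → Set (Λ × Msg) → State

namespace Protocol

variable {V Λ : Type}

/-- In the global state `σ`, the message that `u` sends to `v` in the current step, if any. -/
noncomputable def message (P : Protocol Λ) (N : Network V Λ) (σ : V → P.State) (u v : V) :
    Option P.Msg :=
  open Classical in if N.graph.Adj u v then P.send (σ u) (N.label u v) else none

/-- The global state after `t` steps, with initiator `s`, if in each step `i` the messages on the
arcs in `lost i` are destroyed. -/
noncomputable def state (P : Protocol Λ) (N : Network V Λ) (s : V) (lost : ℕ → Finset (V × V)) :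
    ℕ → V → P.State
  | 0 => fun v => open Classical in if v = s then P.initiatorState else P.otherState
  | t + 1 => fun v => P.receive (state P N s lost t v)
      {p | ∃ u, (u, v) ∉ lost t ∧ p.1 = N.label v u ∧
        P.message N (state P N s lost t) u v = some p.2}

/-- The set of arcs `(u, v)` over which a message is sent in step `t`. -/
noncomputable def sent [Fintype V] (P : Protocol Λ) (N : Network V Λ) (s : V)
    (lost : ℕ → Finset (V × V)) (t : ℕ) : Finset (V × V) :=
  open Classical in
  Finset.univ.filter fun a => P.message N (P.state N s lost t) a.1 a.2 ≠ none

/-- The vertices that have the information after `t` steps. At the start only the initiator `s` has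
it. As message length is unrestricted, every message sent by a vertex that has the information
includes it, so a vertex obtains the information exactly when it receives a message from a vertex
that had it when sending. -/
def informed (P : Protocol Λ) (N : Network V Λ) (s : V) (lost : ℕ → Finset (V × V)) : ℕ → Set V
  | 0 => {s}
  | t + 1 => informed P N s lost t ∪
      {v | ∃ u ∈ informed P N s lost t, (u, v) ∉ lost t ∧
        P.message N (P.state N s lost t) u v ≠ none}

/-- The largest number of messages that the adversary may destroy in a step in which `m` messages
are sent: `max {c(G) - 1, ⌊α m⌋}`. -/
noncomputable def faultBound (α : ℝ) (G : SimpleGraph V) (m : ℕ) : ℕ :=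
  max (edgeConnectivity G - 1) ⌊α * m⌋₊

/-- `P` performs complete broadcasting from `s` within `T` steps under fractional dynamic faults
with threshold: whatever sent messages the adversary destroys in each step, within its bound, all
vertices have the information after `T` steps. Since `P` is deterministic, the strategies of an
adaptive adversary amount to the sequences `lost`. -/
def BroadcastsWithin [Fintype V] (P : Protocol Λ) (α : ℝ) (N : Network V Λ) (s : V) (T : ℕ) :
    Prop :=
  ∀ lost : ℕ → Finset (V × V),
    (∀ t < T, lost t ⊆ P.sent N s lost t ∧
      (lost t).card ≤ faultBound α N.graph (P.sent N s lost t).card) →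
    ∀ v, v ∈ P.informed N s lost T

end Protocol

end FaultyBroadcast

/-!
Once α is replaced by `max α (1/2)`, the adversary can destroy at most `max (n - 2) (α m)` of `m`
messages. The argument is about keeping track of who knows what.

*Spreading a token* (`Spreading.card_tokenless_le`). Each token holder sends to all vertices that
have not acknowledged the token to it, and every vertex that receives something answers at once.
Two rounds reach the fraction `1 - α` of the vertices. From then on, the pushes make up a constant
fraction of the pairs `(u, w)` for which `u` has no acknowledgement from `w`, and a constant fraction
of them is both delivered and acknowledged, unless there are only `O(n)` pushes. So the number of
these pairs decays geometrically, and when it is `O(n)`, only constantly many vertices, `c` say, are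
without the token, because each of them accounts for `(1 - α) n` pairs. This takes `O(log n)` rounds.

*The last vertices.* Knowing a single uninformed vertex `v` is of use only if all other `n - 1`
vertices know it, since `n - 2` messages to `v` can be destroyed. The way out is to keep the
adversary busy at two places at once (`ComplainSpec.progress`): if almost all vertices send both to
`v` and to some other vertex, possibly different ones, that has to be told something, then not all
messages can be destroyed.

* With the initiator in the role of `v`, the uninformed vertices complain to everybody, the
  complaints are spread, and then every vertex that has heard of a complaint sends to the initiator
  and to a complaining vertex. So either an uninformed vertex gets the information, or the initiator
  learns of one, `v` (`report_zero_progress`).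
* The initiator spreads `v` as the nominee. The vertices not reached notice it, as they expect this
  message, and they complain, while all others send to `v`. The number of complaints is constant, so
  that the messages to `v` together with the complaints of the vertices other than `v` exceed the
  budget of the adversary. If `v` is not informed, some complaint gets through; the complaints are
  spread, and now all vertices that have heard of one send to `v` and to a complaining vertex. So `v`
  is informed, or fewer vertices do not know the nominee (`report_progress`). After `c + 1`
  repetitions some vertex has been informed (`rescue_progress`), and `c` rescues inform everybody.

All positions are relative to the initiator; with the chordal sense of direction a vertex computes
its own position from that of the first informed vertex it hears.

For the finitely many remaining `n` it is enough to let the informed vertices send to each set of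
vertices in turn, `n` times over: whenever this set is the set of uninformed vertices, at least
`n - 1` messages are sent, and one gets through (`sweeps_progress`).
-/

namespace ChordalBroadcast

open Finset FaultyBroadcast

variable {n : ℕ}

/-! ### Programs run by all vertices -/

/-- The memory of a vertex. `pos` is its clockwise distance from the initiator (`none` as long as
it lacks the information), `nom` the nominated vertex it has been told of, `tok` the token it holds
in the current spreading phase (the position of some vertex), `known` the labels of its links to
vertices that have acknowledged the token, `pend` the labels over which it has just received
something. -/
structure Reg (n : ℕ) where
  pos : Option (ZMod n)
  nom : Option (ZMod n)
  tok : Option (ZMod n)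
  known : Set (ZMod n)
  pend : Set (ZMod n)

/-- The memory of a vertex without the information. -/
def blank : Reg n := ⟨none, none, none, ∅, ∅⟩

/-- One instruction: the labels over which a vertex sends (a message is always the whole memory of
its sender), and the memory after receiving. -/
structure Op (n : ℕ) where
  sends : Reg n → ZMod n → Prop
  act : Reg n → Set (ZMod n × Reg n) → Reg n

open Classical in
/-- An arbitrary element of `S`, if there is one. -/
noncomputable def pick (S : Set (ZMod n)) : Option (ZMod n) :=
  if h : S.Nonempty then some h.some else none

lemma mem_of_pick {S : Set (ZMod n)} {x : ZMod n} (h : pick S = some x) : x ∈ S := by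
  unfold pick at h
  split_ifs at h with hS
  cases h
  exact hS.some_mem

lemma pick_ne_none {S : Set (ZMod n)} {x : ZMod n} (h : x ∈ S) : pick S ≠ none := by
  unfold pick
  rw [dif_pos ⟨x, h⟩]
  simp

/-- The own position, computed if necessary from that of an informed vertex just heard: a vertex at
`z` whose link has label `ℓ` here is `ℓ` ahead. -/
noncomputable def learn (r : Reg n) (I : Set (ZMod n × Reg n)) : Option (ZMod n) :=
  r.pos.or (pick {x | ∃ p ∈ I, ∃ z, p.2.pos = some z ∧ x = z - p.1})

/-- The own value of a register or, if there is none, one just received. -/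
noncomputable def adopt (f : Reg n → Option (ZMod n)) (r : Reg n) (I : Set (ZMod n × Reg n)) :
    Option (ZMod n) :=
  (f r).or (pick {x | ∃ p ∈ I, f p.2 = some x})

/-- The labels of the links over which something was received. -/
def labels (I : Set (ZMod n × Reg n)) : Set (ZMod n) := {ℓ | ∃ m, (ℓ, m) ∈ I}

/-- The memory after an instruction. A vertex that still lacks the information stays blank. -/
noncomputable def next (op : Op n) (r : Reg n) (I : Set (ZMod n × Reg n)) : Reg n :=
  match learn r I with
  | none => blank
  | some x => { op.act r I with pos := some x }

/-- The protocol that executes a list of instructions, one in each step. -/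
noncomputable def protocol (prog : List (Op n)) : FaultyBroadcast.Protocol (ZMod n) where
  State := List (Op n) × Reg n
  Msg := Reg n
  initiatorState := (prog, ⟨some 0, none, some 0, ∅, ∅⟩)
  otherState := (prog, blank)
  send q ℓ := open Classical in
    match q.1 with
    | [] => none
    | op :: _ => if op.sends q.2 ℓ then some q.2 else none
  receive q I :=
    match q.1 with
    | [] => q
    | op :: l => (l, next op q.2 I)

/-! ### Executions in coordinates -/

/-- A global state, with every vertex named by its clockwise distance from the initiator. -/
abbrev Config (n : ℕ) := ZMod n → Reg n

/-- What `v` receives if the messages on the arcs in `del` are delivered. -/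
def inbox (σ : Config n) (del : Finset (ZMod n × ZMod n)) (v : ZMod n) :
    Set (ZMod n × Reg n) :=
  {p | ∃ u, (u, v) ∈ del ∧ p = (u - v, σ u)}

/-- The adversary may let exactly the messages on the arcs in `del` through. -/
def Allowed (α : ℝ) (S del : Finset (ZMod n × ZMod n)) : Prop :=
  del ⊆ S ∧ (S.card : ℝ) - del.card ≤ max ((n : ℝ) - 2) (α * S.card)

/-- A set of messages that exceeds the adversary's budget is not lost as a whole. -/
lemma Allowed.exists_mem {α : ℝ} {S del Q : Finset (ZMod n × ZMod n)} (h : Allowed α S del)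
    (hQ : Q ⊆ S) (h1 : n ≤ Q.card + 1) (h2 : α * S.card < Q.card) : ∃ a ∈ Q, a ∈ del := by
  by_contra! hc
  have h3 : Q.card + del.card ≤ S.card := by
    rw [← card_union_of_disjoint (Finset.disjoint_left.2 hc)]
    exact card_le_card (union_subset hQ h.1)
  have h4 := h.2
  have h1' : (n : ℝ) ≤ Q.card + 1 := by exact_mod_cast h1
  have h3' : (Q.card : ℝ) + del.card ≤ S.card := by exact_mod_cast h3
  rcases le_max_iff.1 h4 with h5 | h5 <;> linarith

lemma Allowed.exists_mem_of_card {α : ℝ} (hα : α < 1) {S del : Finset (ZMod n × ZMod n)}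
    (hn : 2 ≤ n) (h : Allowed α S del) (h1 : n ≤ S.card + 1) : ∃ a ∈ S, a ∈ del := by
  refine h.exists_mem subset_rfl h1 ?_
  have : (0 : ℝ) < S.card := by
    have : 0 < S.card := by omega
    exact_mod_cast this
  nlinarith

/-- Positions are correct, and vertices without the information are blank. -/
def Good (σ : Config n) : Prop := ∀ v, (σ v).pos = some v ∨ σ v = blank

lemma Good.pos_eq {σ : Config n} (h : Good σ) {v : ZMod n} (hv : (σ v).pos ≠ none) :
    (σ v).pos = some v := by
  rcases h v with h | h
  · exact h
  · rw [h] at hv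
    exact absurd rfl hv

lemma Good.eq_blank {σ : Config n} (h : Good σ) {v : ZMod n} (hv : (σ v).pos = none) :
    σ v = blank := by
  rcases h v with h | h
  · rw [h] at hv
    cases hv
  · exact h

lemma Good.pos_of_nom {σ : Config n} (h : Good σ) {v : ZMod n} (hv : (σ v).nom ≠ none) :
    (σ v).pos = some v :=
  h.pos_eq fun h' => hv (by rw [h.eq_blank h']; rfl)

lemma Good.pos_of_tok {σ : Config n} (h : Good σ) {v : ZMod n} (hv : (σ v).tok ≠ none) :
    (σ v).pos = some v :=
  h.pos_eq fun h' => hv (by rw [h.eq_blank h']; rfl)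

lemma Good.learn_eq {σ : Config n} (h : Good σ) (del : Finset (ZMod n × ZMod n)) {v x : ZMod n}
    (hx : learn (σ v) (inbox σ del v) = some x) : x = v := by
  unfold learn at hx
  cases hp : (σ v).pos with
  | some y =>
    have h1 := h.pos_eq (v := v) (by simp [hp])
    rw [h1] at hx
    simpa using hx.symm
  | none =>
    rw [hp, Option.none_or] at hx
    obtain ⟨p, ⟨u, -, rfl⟩, z, hz, rfl⟩ := mem_of_pick hx
    simp only at hz
    have h1 := h.pos_eq (v := u) (by simp [hz])
    rw [h1] at hz
    cases hz
    simp

lemma learn_ne_none_of_pos {r : Reg n} {I : Set (ZMod n × Reg n)} (h : r.pos ≠ none) :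
    learn r I ≠ none := by
  unfold learn
  simp [h]

lemma learn_ne_none_of_mem {σ : Config n} {del : Finset (ZMod n × ZMod n)} {u v : ZMod n}
    (hd : (u, v) ∈ del) (hu : (σ u).pos ≠ none) : learn (σ v) (inbox σ del v) ≠ none := by
  obtain ⟨z, hz⟩ := Option.ne_none_iff_exists'.1 hu
  unfold learn
  intro h
  rw [Option.or_eq_none_iff] at h
  exact absurd h.2 (pick_ne_none (x := z - (u - v)) ⟨(u - v, σ u), ⟨u, hd, rfl⟩, z, hz, rfl⟩)

lemma next_of_learn {op : Op n} {r : Reg n} {I : Set (ZMod n × Reg n)} (h : learn r I ≠ none) :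
    next op r I = { op.act r I with pos := learn r I } := by
  obtain ⟨z, hz⟩ := Option.ne_none_iff_exists'.1 h
  unfold next
  rw [hz]

lemma next_of_learn_eq_none {op : Op n} {r : Reg n} {I : Set (ZMod n × Reg n)}
    (h : learn r I = none) : next op r I = blank := by
  unfold next
  rw [h]

lemma next_pos {op : Op n} {r : Reg n} {I : Set (ZMod n × Reg n)} :
    (next op r I).pos = learn r I := by
  by_cases h : learn r I = none
  · rw [next_of_learn_eq_none h, h]
    rfl
  · rw [next_of_learn h]

/-! ### Gossiping steps -/

/-- The registers `nom` and `tok` are kept where they are set, every new value is an old one from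
elsewhere, and a token comes along with a nominee. -/
structure Extends (σ σ' : Config n) : Prop where
  nom_keep : ∀ {u v}, (σ u).nom = some v → (σ' u).nom = some v
  nom_source : ∀ {u v}, (σ' u).nom = some v → ∃ w, (σ w).nom = some v
  tok_keep : ∀ {u v}, (σ u).tok = some v → (σ' u).tok = some v
  tok_source : ∀ {u v}, (σ' u).tok = some v → ∃ w, (σ w).tok = some v
  nom_of_tok : (∀ u, (σ u).tok ≠ none → (σ u).nom ≠ none) →
    ∀ u, (σ' u).tok ≠ none → (σ' u).nom ≠ none

lemma Extends.refl (σ : Config n) : Extends σ σ :=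
  ⟨id, fun h => ⟨_, h⟩, id, fun h => ⟨_, h⟩, id⟩

lemma Extends.trans {σ τ ρ : Config n} (h : Extends σ τ) (h' : Extends τ ρ) : Extends σ ρ where
  nom_keep := fun hu => h'.nom_keep (h.nom_keep hu)
  nom_source := fun hu => by
    obtain ⟨w, hw⟩ := h'.nom_source hu
    exact h.nom_source hw
  tok_keep := fun hu => h'.tok_keep (h.tok_keep hu)
  tok_source := fun hu => by
    obtain ⟨w, hw⟩ := h'.tok_source hu
    exact h.tok_source hw
  nom_of_tok := fun hu => h'.nom_of_tok (h.nom_of_tok hu)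

lemma Extends.tok_ne_none {σ τ : Config n} (h : Extends σ τ) {u : ZMod n}
    (hu : (σ u).tok ≠ none) : (τ u).tok ≠ none := by
  obtain ⟨x, hx⟩ := Option.ne_none_iff_exists'.1 hu
  simp [h.tok_keep hx]

lemma Extends.nom_ne_none {σ τ : Config n} (h : Extends σ τ) {u : ZMod n}
    (hu : (σ u).nom ≠ none) : (τ u).nom ≠ none := by
  obtain ⟨x, hx⟩ := Option.ne_none_iff_exists'.1 hu
  simp [h.nom_keep hx]

lemma adopt_eq_some {f : Reg n → Option (ZMod n)} {σ : Config n}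
    {del : Finset (ZMod n × ZMod n)} {v x : ZMod n}
    (h : adopt f (σ v) (inbox σ del v) = some x) :
    f (σ v) = some x ∨ f (σ v) = none ∧ ∃ u, (u, v) ∈ del ∧ f (σ u) = some x := by
  unfold adopt at h
  cases hf : f (σ v) with
  | some y =>
    left
    rw [hf] at h
    simpa using h
  | none =>
    right
    rw [hf, Option.none_or] at h
    obtain ⟨p, ⟨u, hu, rfl⟩, hx⟩ := mem_of_pick h
    exact ⟨rfl, u, hu, hx⟩

lemma adopt_ne_none_of_mem {f : Reg n → Option (ZMod n)} {σ : Config n}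
    {del : Finset (ZMod n × ZMod n)} {u v : ZMod n} (hd : (u, v) ∈ del) (hu : f (σ u) ≠ none) :
    adopt f (σ v) (inbox σ del v) ≠ none := by
  obtain ⟨z, hz⟩ := Option.ne_none_iff_exists'.1 hu
  unfold adopt
  intro h
  rw [Option.or_eq_none_iff] at h
  exact absurd h.2 (pick_ne_none (x := z) ⟨(u - v, σ u), ⟨u, hd, rfl⟩, hz⟩)

lemma adopt_of_some {f : Reg n → Option (ZMod n)} {r : Reg n} {I : Set (ZMod n × Reg n)}
    {x : ZMod n} (h : f r = some x) : adopt f r I = some x := by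
  simp [adopt, h]

/-- The instruction adopts received values of `nom` and `tok`. -/
def Adopting (op : Op n) : Prop :=
  ∀ r I, (op.act r I).nom = adopt Reg.nom r I ∧ (op.act r I).tok = adopt Reg.tok r I

lemma next_nom {op : Op n} (hop : ∀ r I, (op.act r I).nom = adopt Reg.nom r I) {σ : Config n}
    (hg : Good σ) (del : Finset (ZMod n × ZMod n)) (v : ZMod n) :
    (next op (σ v) (inbox σ del v)).nom = adopt Reg.nom (σ v) (inbox σ del v) := by
  by_cases hl : learn (σ v) (inbox σ del v) = none
  · rw [next_of_learn_eq_none hl]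
    by_contra hc
    obtain ⟨x, hx⟩ := Option.ne_none_iff_exists'.1 (Ne.symm hc)
    rcases adopt_eq_some hx with h | ⟨-, u, hu, h⟩
    · exact learn_ne_none_of_pos (by rw [hg.pos_of_nom (by simp [h])]; simp) hl
    · exact learn_ne_none_of_mem hu (by rw [hg.pos_of_nom (by simp [h])]; simp) hl
  · rw [next_of_learn hl]
    exact hop _ _

lemma next_tok {op : Op n} (hop : ∀ r I, (op.act r I).tok = adopt Reg.tok r I) {σ : Config n}
    (hg : Good σ) (del : Finset (ZMod n × ZMod n)) (v : ZMod n) :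
    (next op (σ v) (inbox σ del v)).tok = adopt Reg.tok (σ v) (inbox σ del v) := by
  by_cases hl : learn (σ v) (inbox σ del v) = none
  · rw [next_of_learn_eq_none hl]
    by_contra hc
    obtain ⟨x, hx⟩ := Option.ne_none_iff_exists'.1 (Ne.symm hc)
    rcases adopt_eq_some hx with h | ⟨-, u, hu, h⟩
    · exact learn_ne_none_of_pos (by rw [hg.pos_of_tok (by simp [h])]; simp) hl
    · exact learn_ne_none_of_mem hu (by rw [hg.pos_of_tok (by simp [h])]; simp) hl
  · rw [next_of_learn hl]
    exact hop _ _

lemma Adopting.extends_next {op : Op n} (hop : Adopting op) {σ σ' : Config n} (hg : Good σ)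
    {del : Finset (ZMod n × ZMod n)} (h : ∀ v, σ' v = next op (σ v) (inbox σ del v)) :
    Extends σ σ' := by
  have hn : ∀ v, (σ' v).nom = adopt Reg.nom (σ v) (inbox σ del v) := fun v => by
    rw [h, next_nom (fun r I => (hop r I).1) hg]
  have ht : ∀ v, (σ' v).tok = adopt Reg.tok (σ v) (inbox σ del v) := fun v => by
    rw [h, next_tok (fun r I => (hop r I).2) hg]
  refine ⟨fun hu => ?_, fun {u v} hu => ?_, fun hu => ?_, fun {u v} hu => ?_, fun hl u hu => ?_⟩
  · rw [hn, adopt_of_some hu]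
  · rw [hn] at hu
    rcases adopt_eq_some hu with h | ⟨-, w, -, h⟩
    exacts [⟨u, h⟩, ⟨w, h⟩]
  · rw [ht, adopt_of_some hu]
  · rw [ht] at hu
    rcases adopt_eq_some hu with h | ⟨-, w, -, h⟩
    exacts [⟨u, h⟩, ⟨w, h⟩]
  · rw [ht] at hu
    rw [hn]
    obtain ⟨x, hx⟩ := Option.ne_none_iff_exists'.1 hu
    rcases adopt_eq_some hx with h | ⟨-, w, hw, h⟩
    · obtain ⟨z, hz⟩ := Option.ne_none_iff_exists'.1 (hl u (by simp [h]))
      simp [adopt_of_some hz]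
    · exact adopt_ne_none_of_mem hw (hl w (by simp [h]))

/-! ### Steps and executions -/

section
variable [NeZero n]


open Classical in
/-- The arcs over which a message is sent. -/
noncomputable def sent (op : Op n) (σ : Config n) : Finset (ZMod n × ZMod n) :=
  univ.filter fun a => a.1 ≠ a.2 ∧ op.sends (σ a.1) (a.2 - a.1)

@[simp] lemma mem_sent {op : Op n} {σ : Config n} {u v : ZMod n} :
    (u, v) ∈ sent op σ ↔ u ≠ v ∧ op.sends (σ u) (v - u) := by
  simp [sent]

/-- One step with instruction `op`, for some behaviour of the adversary. -/
def Step (α : ℝ) (op : Op n) (σ σ' : Config n) : Prop :=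
  ∃ del, Allowed α (sent op σ) del ∧ ∀ v, σ' v = next op (σ v) (inbox σ del v)

/-- `Exec α prog σ σ'`: the program `prog` can lead from `σ` to `σ'`. -/
def Exec (α : ℝ) : List (Op n) → Config n → Config n → Prop
  | [], σ, σ' => σ = σ'
  | op :: l, σ, σ' => ∃ τ, Step α op σ τ ∧ Exec α l τ σ'

lemma exec_append {α : ℝ} {l l' : List (Op n)} {σ σ' : Config n} :
    Exec α (l ++ l') σ σ' ↔ ∃ τ, Exec α l σ τ ∧ Exec α l' τ σ' := by
  induction l generalizing σ with
  | nil => simp [Exec]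
  | cons op l ih =>
    simp only [List.cons_append, Exec, ih]
    constructor
    · rintro ⟨τ, h, τ', h', h''⟩
      exact ⟨τ', ⟨τ, h, h'⟩, h''⟩
    · rintro ⟨τ', ⟨τ, h, h'⟩, h''⟩
      exact ⟨τ, h, τ', h', h''⟩

lemma Step.good {α : ℝ} {op : Op n} {σ σ' : Config n} (h : Step α op σ σ') (hg : Good σ) :
    Good σ' := by
  obtain ⟨del, -, h⟩ := h
  intro v
  by_cases hl : learn (σ v) (inbox σ del v) = none
  · right
    rw [h, next_of_learn_eq_none hl]
  · left
    obtain ⟨z, hz⟩ := Option.ne_none_iff_exists'.1 hl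
    rw [h, next_pos, hz, hg.learn_eq del hz]

lemma Step.pos_mono {α : ℝ} {op : Op n} {σ σ' : Config n} (h : Step α op σ σ') {v : ZMod n}
    (hv : (σ v).pos ≠ none) : (σ' v).pos ≠ none := by
  obtain ⟨del, -, h⟩ := h
  rw [h, next_pos]
  exact learn_ne_none_of_pos hv

lemma Exec.good {α : ℝ} {l : List (Op n)} {σ σ' : Config n} (h : Exec α l σ σ') (hg : Good σ) :
    Good σ' := by
  induction l generalizing σ with
  | nil =>
    cases h
    exact hg
  | cons op l ih =>
    obtain ⟨τ, h1, h2⟩ := h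
    exact ih h2 (h1.good hg)

lemma Exec.pos_mono {α : ℝ} {l : List (Op n)} {σ σ' : Config n} (h : Exec α l σ σ') {v : ZMod n}
    (hv : (σ v).pos ≠ none) : (σ' v).pos ≠ none := by
  induction l generalizing σ with
  | nil =>
    cases h
    exact hv
  | cons op l ih =>
    obtain ⟨τ, h1, h2⟩ := h
    exact ih h2 (h1.pos_mono hv)

open Classical in
/-- The vertices without the information. -/
noncomputable def uninformed (σ : Config n) : Finset (ZMod n) :=
  univ.filter fun v => (σ v).pos = none

@[simp] lemma mem_uninformed {σ : Config n} {v : ZMod n} :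
    v ∈ uninformed σ ↔ (σ v).pos = none := by
  simp [uninformed]

lemma Exec.uninformed_subset {α : ℝ} {l : List (Op n)} {σ σ' : Config n} (h : Exec α l σ σ') :
    uninformed σ' ⊆ uninformed σ := by
  intro v hv
  rw [mem_uninformed] at hv ⊢
  by_contra hc
  exact h.pos_mono hc hv

lemma Step.exec {α : ℝ} {op : Op n} {σ σ' : Config n} (h : Step α op σ σ') :
    Exec α [op] σ σ' := ⟨σ', h, rfl⟩

/-- If `v` gets the information, fewer vertices lack it. -/
lemma Exec.uninformed_card_lt {α : ℝ} {l : List (Op n)} {σ σ' : Config n} (h : Exec α l σ σ')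
    {v : ZMod n} (hv : (σ v).pos = none) (hv' : (σ' v).pos ≠ none) :
    (uninformed σ').card < (uninformed σ).card :=
  card_lt_card ⟨h.uninformed_subset, fun hs => hv' (mem_uninformed.1 (hs (by simpa using hv)))⟩

end

/-! ### Spreading a token with acknowledgements -/

/-- Every token holder sends to all vertices that have not acknowledged the token to it. -/
noncomputable def push : Op n where
  sends r ℓ := r.tok ≠ none ∧ ℓ ∉ r.known
  act r I := ⟨none, adopt Reg.nom r I, adopt Reg.tok r I, r.known, labels I⟩

/-- Every vertex answers the messages of the preceding step. -/
noncomputable def ack : Op n where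
  sends r ℓ := ℓ ∈ r.pend
  act r I := ⟨none, adopt Reg.nom r I, adopt Reg.tok r I, r.known ∪ labels I, ∅⟩

/-- A phase of `R` rounds that spreads tokens. -/
noncomputable def spread : ℕ → List (Op n)
  | 0 => []
  | R + 1 => push :: ack :: spread R

lemma length_spread (R : ℕ) : (spread R : List (Op n)).length = 2 * R := by
  induction R with
  | zero => rfl
  | succ R ih => simp only [spread, List.length_cons, ih]; ring

lemma adopting_push : Adopting (push : Op n) := fun _ _ => ⟨rfl, rfl⟩

lemma adopting_ack : Adopting (ack : Op n) := fun _ _ => ⟨rfl, rfl⟩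

lemma mem_labels_inbox {σ : Config n} {del : Finset (ZMod n × ZMod n)} {u v : ZMod n} :
    u - v ∈ labels (inbox σ del v) ↔ (u, v) ∈ del := by
  constructor
  · rintro ⟨m, w, hw, h⟩
    obtain rfl : u = w := sub_left_injective (congrArg Prod.fst h)
    exact hw
  · exact fun h => ⟨σ u, u, h, rfl⟩

section
variable [NeZero n]

open Classical in
/-- The vertices without a token. -/
noncomputable def tokenless (σ : Config n) : Finset (ZMod n) :=
  univ.filter fun v => (σ v).tok = none

@[simp] lemma mem_tokenless {σ : Config n} {v : ZMod n} :
    v ∈ tokenless σ ↔ (σ v).tok = none := by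
  simp [tokenless]

open Classical in
/-- The arcs `(u, w)` such that `u` has no acknowledgement from `w`. -/
noncomputable def unacked (σ : Config n) : Finset (ZMod n × ZMod n) :=
  univ.filter fun a => a.1 ≠ a.2 ∧ a.2 - a.1 ∉ (σ a.1).known

@[simp] lemma mem_unacked {σ : Config n} {u w : ZMod n} :
    (u, w) ∈ unacked σ ↔ u ≠ w ∧ w - u ∉ (σ u).known := by
  simp [unacked]

/-- Acknowledgements come from token holders to token holders. -/
structure Spreading (σ : Config n) : Prop where
  good : Good σ
  known : ∀ {u w}, w - u ∈ (σ u).known → (σ u).tok ≠ none ∧ (σ w).tok ≠ none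

lemma card_tokenless_add (σ : Config n) : (tokenless σ).card + (tokenless σ)ᶜ.card = n := by
  rw [card_add_card_compl, ZMod.card]

lemma Extends.tokenless_subset {σ σ' : Config n} (h : Extends σ σ') :
    tokenless σ' ⊆ tokenless σ := by
  intro u hu
  rw [mem_tokenless] at hu ⊢
  by_contra hc
  exact h.tok_ne_none hc hu

/-- What one round (a push and the acknowledgements) achieves: `d₁` pushes and `d₂`
acknowledgements are delivered. -/
structure RoundSpec (α : ℝ) (σ ρ : Config n) (d₁ d₂ : ℕ) : Prop where
  ext : Extends σ ρ
  spreading : Spreading ρ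
  push_le : ((sent push σ).card : ℝ) - d₁ ≤ max ((n : ℝ) - 2) (α * (sent push σ).card)
  ack_le : (d₁ : ℝ) - d₂ ≤ max ((n : ℝ) - 2) (α * d₁)
  unacked_le : (unacked ρ).card + d₂ ≤ (unacked σ).card
  reach : ((tokenless σ)ᶜ.card : ℝ) * (tokenless ρ).card
    ≤ max ((n : ℝ) - 2) (α * (sent push σ).card)

lemma Spreading.round {α : ℝ} {σ τ ρ : Config n} (hs : Spreading σ) (h1 : Step α push σ τ)
    (h2 : Step α ack τ ρ) : ∃ d₁ d₂, RoundSpec α σ ρ d₁ d₂ := by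
  have hgτ : Good τ := h1.good hs.good
  have hgρ : Good ρ := h2.good hgτ
  obtain ⟨del, hdel, h1⟩ := h1
  obtain ⟨del', hdel', h2⟩ := h2
  have e1 : Extends σ τ := adopting_push.extends_next hs.good h1
  have e2 : Extends τ ρ := adopting_ack.extends_next hgτ h2
  have hd : ∀ {u v}, (u, v) ∈ del → u ≠ v ∧ (σ u).tok ≠ none ∧ v - u ∉ (σ u).known :=
    fun h => mem_sent.1 (hdel.1 h)
  -- A push reaching `v` makes it a token holder that remembers whom to answer.
  have hlearn : ∀ {u v}, (u, v) ∈ del → learn (σ v) (inbox σ del v) ≠ none := fun h =>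
    learn_ne_none_of_mem h (by rw [hs.good.pos_of_tok (hd h).2.1]; simp)
  have htok : ∀ {u v}, (u, v) ∈ del → (τ v).tok ≠ none := fun {u v} h => by
    rw [h1, next_tok (fun _ _ => rfl) hs.good]
    exact adopt_ne_none_of_mem h (hd h).2.1
  have hpend : ∀ {u v}, u - v ∈ (τ v).pend ↔ (u, v) ∈ del := by
    intro u v
    constructor
    · intro h
      rw [h1] at h
      by_cases hl : learn (σ v) (inbox σ del v) = none
      · rw [next_of_learn_eq_none hl] at h
        exact h.elim
      · rw [next_of_learn hl] at h
        exact mem_labels_inbox.1 h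
    · intro h
      rw [h1, next_of_learn (hlearn h)]
      exact mem_labels_inbox.2 h
  have hknown : ∀ u, (τ u).known = (σ u).known := by
    intro u
    rw [h1]
    by_cases hl : learn (σ u) (inbox σ del u) = none
    · rw [next_of_learn_eq_none hl]
      have hp : (σ u).pos = none := by
        by_contra hc
        exact learn_ne_none_of_pos hc hl
      rw [hs.good.eq_blank hp]
    · rw [next_of_learn hl]
      rfl
  have hd' : ∀ {u v}, (u, v) ∈ del' → (v, u) ∈ del := fun h => hpend.1 (mem_sent.1 (hdel'.1 h)).2
  have hsent' : sent ack τ = del.image Prod.swap := by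
    ext ⟨u, v⟩
    rw [mem_sent]
    simp only [mem_image, Prod.exists, Prod.swap_prod_mk, Prod.mk.injEq]
    constructor
    · intro h
      exact ⟨v, u, hpend.1 h.2, rfl, rfl⟩
    · rintro ⟨a, b, h, rfl, rfl⟩
      exact ⟨(hd h).1.symm, hpend.2 h⟩
  have hcard : (sent ack τ).card = del.card := by
    rw [hsent', card_image_of_injective _ Prod.swap_injective]
  have hτpos : ∀ {u w}, (u, w) ∈ del → (τ u).pos ≠ none := fun {u w} h => by
    rw [hgτ.pos_of_tok (e1.tok_ne_none (hd h).2.1)]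
    simp
  have hkρ : ∀ {u w}, w - u ∈ (ρ u).known ↔ w - u ∈ (σ u).known ∨ (w, u) ∈ del' := by
    intro u w
    by_cases hl : learn (τ u) (inbox τ del' u) = none
    · rw [h2, next_of_learn_eq_none hl]
      have hp : (τ u).pos = none := by
        by_contra hc
        exact learn_ne_none_of_pos hc hl
      constructor
      · exact fun h => h.elim
      · rintro (h | h)
        · rw [← hknown, hgτ.eq_blank hp] at h
          exact h
        · exact absurd hp (hτpos (hd' h))
    · rw [h2, next_of_learn hl]
      change w - u ∈ (τ u).known ∪ labels (inbox τ del' u) ↔ _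
      rw [Set.mem_union, hknown, mem_labels_inbox]
  refine ⟨del.card, del'.card, e1.trans e2, ⟨hgρ, ?_⟩, hdel.2, ?_, ?_, ?_⟩
  · intro u w h
    rcases hkρ.1 h with h | h
    · exact ⟨(e1.trans e2).tok_ne_none (hs.known h).1, (e1.trans e2).tok_ne_none (hs.known h).2⟩
    · exact ⟨(e1.trans e2).tok_ne_none (hd (hd' h)).2.1, e2.tok_ne_none (htok (hd' h))⟩
  · have := hdel'.2
    rwa [hcard] at this
  · rw [← card_image_of_injective del' Prod.swap_injective, ← card_union_of_disjoint]
    · apply card_le_card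
      rintro ⟨u, w⟩ h
      rw [mem_union, mem_unacked, mem_image] at h
      rw [mem_unacked]
      rcases h with h | ⟨⟨a, b⟩, h, hab⟩
      · exact ⟨h.1, fun hc => h.2 (hkρ.2 (Or.inl hc))⟩
      · cases hab
        exact ⟨(hd (hd' h)).1, (hd (hd' h)).2.2⟩
    · rw [Finset.disjoint_left]
      rintro ⟨u, w⟩ h h'
      rw [mem_unacked] at h
      rw [mem_image] at h'
      obtain ⟨⟨a, b⟩, h', hab⟩ := h'
      cases hab
      exact h.2 (hkρ.2 (Or.inr h'))
  · -- No push towards a vertex that is still tokenless afterwards can have been delivered.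
    have hQ : (tokenless σ)ᶜ ×ˢ tokenless ρ ⊆ sent push σ \ del := by
      rintro ⟨u, w⟩ h
      rw [mem_product, mem_compl, mem_tokenless, mem_tokenless] at h
      have hw : (σ w).tok = none := by
        by_contra hc
        exact (e1.trans e2).tok_ne_none hc h.2
      rw [mem_sdiff, mem_sent]
      refine ⟨⟨?_, h.1, fun hc => (hs.known hc).2 hw⟩, fun hc => e2.tok_ne_none (htok hc) h.2⟩
      rintro rfl
      exact h.1 hw
    have h3 := card_le_card hQ
    rw [card_product, card_sdiff_of_subset hdel.1] at h3
    have h4 := card_le_card hdel.1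
    have h5 : (((tokenless σ)ᶜ.card * (tokenless ρ).card + del.card : ℕ) : ℝ)
        ≤ (sent push σ).card := by
      exact_mod_cast (by omega)
    push_cast at h5
    linarith [hdel.2]

lemma card_sent_push_le (σ : Config n) :
    (sent push σ).card ≤ (tokenless σ)ᶜ.card * (n - 1) := by
  have hsub : sent push σ ⊆ (tokenless σ)ᶜ.biUnion fun u => (univ.erase u).image fun w => (u, w) := by
    rintro ⟨u, w⟩ h
    rw [mem_sent] at h
    simp only [mem_biUnion, mem_compl, mem_tokenless, mem_image, mem_erase, mem_univ, and_true]
    exact ⟨u, h.2.1, w, h.1.symm, rfl⟩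
  refine (card_le_card hsub).trans (card_biUnion_le_card_mul _ _ _ fun u _ => ?_)
  refine card_image_le.trans ?_
  rw [card_erase_of_mem (mem_univ _), card_univ, ZMod.card]

lemma card_unacked_le (σ : Config n) :
    (unacked σ).card ≤ (sent push σ).card + (tokenless σ).card * n := by
  have hsub : unacked σ ⊆ sent push σ ∪ tokenless σ ×ˢ univ := by
    rintro ⟨u, w⟩ h
    rw [mem_unacked] at h
    rw [mem_union, mem_sent, mem_product, mem_tokenless]
    by_cases hu : (σ u).tok = none
    · exact Or.inr ⟨hu, mem_univ _⟩
    · exact Or.inl ⟨h.1, hu, h.2⟩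
  refine (card_le_card hsub).trans ((card_union_le _ _).trans ?_)
  rw [card_product, card_univ, ZMod.card]

lemma mul_card_le_card_sent_push (σ : Config n) (hs : Spreading σ) :
    (tokenless σ)ᶜ.card * (tokenless σ).card ≤ (sent push σ).card := by
  rw [← card_product]
  apply card_le_card
  rintro ⟨u, w⟩ h
  rw [mem_product, mem_compl, mem_tokenless, mem_tokenless] at h
  rw [mem_sent]
  refine ⟨?_, h.1, fun hc => (hs.known hc).2 h.2⟩
  rintro rfl
  exact h.1 h.2

lemma card_unacked_le_sq (σ : Config n) : (unacked σ).card ≤ n * n := by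
  refine (card_le_univ _).trans ?_
  rw [Fintype.card_prod, ZMod.card]

/-- A spreading phase keeps `Spreading` and only adopts. -/
lemma Spreading.exec {α : ℝ} {R : ℕ} {σ σ' : Config n} (hs : Spreading σ)
    (h : Exec α (spread R) σ σ') : Extends σ σ' ∧ Spreading σ' := by
  induction R generalizing σ with
  | zero =>
    cases h
    exact ⟨Extends.refl _, hs⟩
  | succ R ih =>
    obtain ⟨τ, h1, ρ, h2, h3⟩ := h
    obtain ⟨d₁, d₂, hr⟩ := hs.round h1 h2
    obtain ⟨h4, h5⟩ := ih hr.spreading h3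
    exact ⟨hr.ext.trans h4, h5⟩

end

/-- The factor by which a round decreases the number of missing acknowledgements. -/
noncomputable def decay (α : ℝ) : ℝ := 1 - (1 - α) ^ 3 / (2 - α)

section
variable [NeZero n] {α : ℝ} (hα : 1 / 2 ≤ α) (hα1 : α < 1)
include hα hα1

/-- Two rounds of pushing reach the fraction `1 - α` of the vertices. -/
lemma card_tokenless_after_two (hn : 2 ≤ n) {σ ρ ρ' : Config n} {d₁ d₂ e₁ e₂ : ℕ}
    (hne : ∃ u, (σ u).tok ≠ none) (h1 : RoundSpec α σ ρ d₁ d₂)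
    (h2 : RoundSpec α ρ ρ' e₁ e₂) : ((tokenless ρ').card : ℝ) ≤ α * n := by
  have hn' : (2 : ℝ) ≤ n := by exact_mod_cast hn
  have key : ∀ σ : Config n, ((sent push σ).card : ℝ) ≤ (tokenless σ)ᶜ.card * ((n : ℝ) - 1) := by
    intro σ
    have := card_sent_push_le σ
    have h : (((sent push σ).card : ℕ) : ℝ) ≤ (((tokenless σ)ᶜ.card * (n - 1) : ℕ) : ℝ) := by
      exact_mod_cast this
    rwa [Nat.cast_mul, Nat.cast_sub (by omega), Nat.cast_one] at h
  have hk : 1 ≤ (tokenless σ)ᶜ.card := by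
    obtain ⟨u, hu⟩ := hne
    exact card_pos.2 ⟨u, by simpa using hu⟩
  have hsub := card_le_card h1.ext.tokenless_subset
  have hsum := card_tokenless_add σ
  have hsum' := card_tokenless_add ρ
  -- After the first round there are at least two token holders.
  have hk2 : 2 ≤ (tokenless ρ)ᶜ.card := by
    by_contra hc
    have e1 : (tokenless σ)ᶜ.card = 1 := by omega
    have e2 : (tokenless ρ).card + 1 = n := by omega
    have h3 := h1.reach
    have h4 := key σ
    have e2' : ((tokenless ρ).card : ℝ) = n - 1 := by
      have : ((tokenless ρ).card : ℝ) + 1 = n := by exact_mod_cast e2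
      linarith
    rw [e1, e2'] at h3
    rw [e1] at h4
    rcases le_max_iff.1 h3 with h5 | h5
    · norm_num at h5
      linarith
    · norm_num at h4 h5
      nlinarith
  have h3 := h2.reach
  have h4 := key ρ
  have hk2' : (2 : ℝ) ≤ (tokenless ρ)ᶜ.card := by exact_mod_cast hk2
  have hnn : (0 : ℝ) ≤ (tokenless ρ').card := by positivity
  rcases le_max_iff.1 h3 with h5 | h5
  · nlinarith
  · have h6 : ((tokenless ρ)ᶜ.card : ℝ) * (tokenless ρ').card
        ≤ (tokenless ρ)ᶜ.card * (α * ((n : ℝ) - 1)) := by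
      calc _ ≤ _ := h5
        _ ≤ α * ((tokenless ρ)ᶜ.card * ((n : ℝ) - 1)) := by gcongr
        _ = _ := by ring
    have h7 := le_of_mul_le_mul_left h6 (by linarith)
    linarith

/-- As long as more than constantly many vertices are tokenless, a round delivers a constant
fraction of the missing acknowledgements. -/
lemma RoundSpec.decay_or {c : ℕ} (hc : 1 / (α * (1 - α) ^ 2) ≤ c) {σ ρ : Config n} {d₁ d₂ : ℕ}
    (hs : Spreading σ) (hu : ((tokenless σ).card : ℝ) ≤ α * n) (h : RoundSpec α σ ρ d₁ d₂) :
    (tokenless σ).card ≤ c ∨ ((unacked ρ).card : ℝ) ≤ decay α * (unacked σ).card := by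
  have hα0 : 0 < α := by linarith
  have hβ : 0 < 1 - α := by linarith
  have hn0 : (0 : ℝ) < n := by exact_mod_cast Nat.pos_of_ne_zero (NeZero.ne n)
  have hsum : ((tokenless σ).card : ℝ) + (tokenless σ)ᶜ.card = n := by
    exact_mod_cast card_tokenless_add σ
  have hk : (1 - α) * n ≤ (tokenless σ)ᶜ.card := by linarith
  have hM : ((tokenless σ)ᶜ.card : ℝ) * (tokenless σ).card ≤ (sent push σ).card := by
    exact_mod_cast mul_card_le_card_sent_push σ hs
  have hΦ : ((unacked σ).card : ℝ) ≤ (sent push σ).card + (tokenless σ).card * n := by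
    exact_mod_cast card_unacked_le σ
  have hU : ((unacked ρ).card : ℝ) + d₂ ≤ (unacked σ).card := by exact_mod_cast h.unacked_le
  have h1 := h.push_le
  have h2 := h.ack_le
  set M : ℝ := ((sent push σ).card : ℝ)
  set u : ℝ := ((tokenless σ).card : ℝ)
  have hu0 : 0 ≤ u := by positivity
  have hku : (1 - α) * n * u ≤ M := (mul_le_mul_of_nonneg_right hk hu0).trans hM
  by_cases hbig : n ≤ α * (1 - α) * M
  · right
    have hMn : 0 ≤ M := by positivity
    have hαM : (n : ℝ) ≤ α * M := by nlinarith [mul_nonneg hα0.le hMn]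
    rw [max_eq_right (by linarith)] at h1
    have hd1 : (1 - α) * M ≤ d₁ := by linarith
    have hαd : (n : ℝ) ≤ α * d₁ := by nlinarith
    rw [max_eq_right (by linarith)] at h2
    have hd2 : (1 - α) ^ 2 * M ≤ d₂ := by nlinarith
    have hΦ' : (1 - α) * (unacked σ).card ≤ (2 - α) * M := by nlinarith
    have h3 : (1 - α) ^ 3 / (2 - α) * (unacked σ).card ≤ d₂ := by
      rw [div_mul_eq_mul_div, div_le_iff₀ (by linarith)]
      calc (1 - α) ^ 3 * ((unacked σ).card : ℝ)
          = (1 - α) ^ 2 * ((1 - α) * (unacked σ).card) := by ring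
        _ ≤ (1 - α) ^ 2 * ((2 - α) * M) := by gcongr
        _ = (2 - α) * ((1 - α) ^ 2 * M) := by ring
        _ ≤ (2 - α) * d₂ := by
            have : 0 ≤ 2 - α := by linarith
            gcongr
        _ = d₂ * (2 - α) := by ring
    unfold decay
    linarith
  · left
    push Not at hbig
    have h3 : α * (1 - α) ^ 2 * u * n < 1 * n := by
      calc α * (1 - α) ^ 2 * u * n = α * (1 - α) * ((1 - α) * n * u) := by ring
        _ ≤ α * (1 - α) * M := by gcongr
        _ < 1 * n := by linarith
    have h4 : α * (1 - α) ^ 2 * u < 1 := lt_of_mul_lt_mul_right h3 hn0.le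
    have h5 : u ≤ c := by
      refine le_trans ?_ hc
      rw [le_div_iff₀ (by positivity)]
      linarith
    exact Nat.cast_le.1 h5

lemma decay_pos : 0 < decay α := by
  unfold decay
  have h1 : (1 - α) ^ 3 / (2 - α) < 1 := by
    rw [div_lt_one (by linarith)]
    have : (1 - α) ^ 3 ≤ 1 := pow_le_one₀ (by linarith) (by linarith)
    linarith
  linarith

lemma decay_lt_one : decay α < 1 := by
  unfold decay
  have : 0 < (1 - α) ^ 3 / (2 - α) := div_pos (pow_pos (by linarith) 3) (by linarith)
  linarith

/-- The decrease of the number of missing acknowledgements, iterated. -/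
lemma Spreading.card_tokenless_or {c : ℕ} (hc : 1 / (α * (1 - α) ^ 2) ≤ c) {R : ℕ}
    {σ σ' : Config n} (hs : Spreading σ) (hu : ((tokenless σ).card : ℝ) ≤ α * n)
    (h : Exec α (spread R) σ σ') :
    (tokenless σ').card ≤ c ∨ ((unacked σ').card : ℝ) ≤ decay α ^ R * (unacked σ).card := by
  induction R generalizing σ with
  | zero =>
    cases h
    simp
  | succ R ih =>
    obtain ⟨τ, h1, ρ, h2, h3⟩ := h
    obtain ⟨d₁, d₂, hr⟩ := hs.round h1 h2
    have hsub := card_le_card hr.ext.tokenless_subset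
    have hsub' := card_le_card (hr.spreading.exec h3).1.tokenless_subset
    have hu' : ((tokenless ρ).card : ℝ) ≤ α * n := le_trans (by exact_mod_cast hsub) hu
    rcases hr.decay_or hα hα1 hc hs hu with h4 | h4
    · left
      omega
    · rcases ih hr.spreading hu' h3 with h5 | h5
      · exact Or.inl h5
      · right
        calc ((unacked σ').card : ℝ) ≤ _ := h5
          _ ≤ decay α ^ R * (decay α * (unacked σ).card) := by
              have := (decay_pos hα hα1).le
              gcongr
          _ = _ := by ring

/-- **Almost complete spreading.** If some vertex holds a token, then logarithmically many rounds
leave at most constantly many vertices without one. -/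
theorem Spreading.card_tokenless_le (hn : 2 ≤ n) {c : ℕ} (hc : 1 / (α * (1 - α) ^ 2) ≤ c) {R : ℕ}
    (hR : decay α ^ R * n ≤ 1) {σ σ' : Config n} (hs : Spreading σ)
    (hne : ∃ u, (σ u).tok ≠ none) (h : Exec α (spread (R + 2)) σ σ') :
    (tokenless σ').card ≤ c := by
  obtain ⟨τ₁, h1, ρ₁, h2, τ₂, h3, ρ₂, h4, h5⟩ := h
  obtain ⟨d₁, d₂, hr⟩ := hs.round h1 h2
  obtain ⟨e₁, e₂, hr'⟩ := hr.spreading.round h3 h4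
  have hu := card_tokenless_after_two hα hα1 hn hne hr hr'
  obtain ⟨hext, hs'⟩ := hr'.spreading.exec h5
  have hα0 : 0 < α := by linarith
  have hβ : 0 < 1 - α := by linarith
  have hn0 : (0 : ℝ) < n := by exact_mod_cast (by omega : 0 < n)
  rcases hr'.spreading.card_tokenless_or hα hα1 hc hu h5 with h6 | h6
  · exact h6
  · have h7 : ((unacked ρ₂).card : ℝ) ≤ n * n := by exact_mod_cast card_unacked_le_sq ρ₂
    have h8 : ((unacked σ').card : ℝ) ≤ n := by
      calc ((unacked σ').card : ℝ) ≤ _ := h6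
        _ ≤ decay α ^ R * (n * n) := by
            have := (decay_pos hα hα1).le
            gcongr
        _ = (decay α ^ R * n) * n := by ring
        _ ≤ 1 * n := by gcongr
        _ = n := one_mul _
    have hsent : ((sent push σ').card : ℝ) ≤ (unacked σ').card := by
      have : sent push σ' ⊆ unacked σ' := by
        rintro ⟨u, w⟩ h
        rw [mem_sent] at h
        exact mem_unacked.2 ⟨h.1, h.2.2⟩
      exact_mod_cast card_le_card this
    have hM : ((tokenless σ')ᶜ.card : ℝ) * (tokenless σ').card ≤ (sent push σ').card := by
      exact_mod_cast mul_card_le_card_sent_push σ' hs'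
    have hsum : ((tokenless σ').card : ℝ) + (tokenless σ')ᶜ.card = n := by
      exact_mod_cast card_tokenless_add σ'
    have hle : ((tokenless σ').card : ℝ) ≤ (tokenless ρ₂).card := by
      exact_mod_cast card_le_card hext.tokenless_subset
    have hk : (1 - α) * n ≤ (tokenless σ')ᶜ.card := by linarith
    have hu0 : (0 : ℝ) ≤ (tokenless σ').card := by positivity
    have h9 : (1 - α) * n * (tokenless σ').card ≤ n :=
      (mul_le_mul_of_nonneg_right hk hu0).trans (by linarith)
    have h10 : (1 - α) * (tokenless σ').card ≤ 1 := by
      refine le_of_mul_le_mul_right ?_ hn0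
      linarith
    have h11 : ((tokenless σ').card : ℝ) ≤ c := by
      refine le_trans ?_ hc
      rw [le_div_iff₀ (by positivity)]
      have : α * (1 - α) ≤ 1 := by nlinarith
      calc ((tokenless σ').card : ℝ) * (α * (1 - α) ^ 2)
          = (α * (1 - α)) * ((1 - α) * (tokenless σ').card) := by ring
        _ ≤ 1 * 1 := by gcongr
        _ = 1 := one_mul 1
    exact_mod_cast h11

end

/-! ### Complaints and their treatment -/

/-- The vertices that know of no nominee complain over the links with label in `L`; if `help`
holds, the others send to the nominee. A vertex that knows the nominee and receives a complaint from
another vertex takes the position of such a vertex as its token. -/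
noncomputable def complain (L : Set (ZMod n)) (help : Prop) : Op n where
  sends r ℓ := (r.nom = none ∧ ℓ ∈ L) ∨
    (help ∧ ∃ p v, r.pos = some p ∧ r.nom = some v ∧ p + ℓ = v)
  act r I := ⟨none, adopt Reg.nom r I,
    pick {x | ∃ v p, r.nom = some v ∧ r.pos = some p ∧ x ≠ v ∧
      ∃ q ∈ I, q.2.nom = none ∧ x = p + q.1}, ∅, ∅⟩

/-- Every token holder sends to the nominee and to the vertex that its token names. -/
noncomputable def target : Op n where
  sends r ℓ := r.tok ≠ none ∧ ∃ p, r.pos = some p ∧ (r.tok = some (p + ℓ) ∨ r.nom = some (p + ℓ))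
  act r I := ⟨none, adopt Reg.nom r I, adopt Reg.tok r I, ∅, ∅⟩

lemma adopting_target : Adopting (target : Op n) := fun _ _ => ⟨rfl, rfl⟩

/-- Complaints are collected, spread, and acted upon. -/
noncomputable def report (R : ℕ) (L : Set (ZMod n)) (help : Prop) : List (Op n) :=
  complain L help :: (spread R ++ [target])

/-- There is no nominee other than `v`. -/
def Nominated (σ : Config n) (v : ZMod n) : Prop := ∀ u w, (σ u).nom = some w → w = v

lemma Nominated.nom_eq {σ : Config n} {v u : ZMod n} (h : Nominated σ v) (hu : (σ u).nom ≠ none) :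
    (σ u).nom = some v := by
  obtain ⟨w, hw⟩ := Option.ne_none_iff_exists'.1 hu
  rw [hw, h u w hw]

lemma Extends.nominated {σ τ : Config n} {v : ZMod n} (h : Extends σ τ) (hv : Nominated σ v) :
    Nominated τ v := fun _ _ hu => by
  obtain ⟨w, hw⟩ := h.nom_source hu
  exact hv _ _ hw

/-- The effect of a complaint step in which exactly the messages on the arcs in `del` arrive. -/
structure ComplainSpec (σ τ : Config n) (v : ZMod n) (del : Finset (ZMod n × ZMod n)) : Prop where
  nom_keep : ∀ {u}, (σ u).nom ≠ none → (τ u).nom ≠ none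
  nominated : Nominated τ v
  known : ∀ u, (τ u).known = ∅
  tok_spec : ∀ {y x}, (τ y).tok = some x → (σ y).nom ≠ none ∧ (σ x).nom = none ∧ x ≠ v
  tok_of_mem : ∀ {x y}, (x, y) ∈ del → (σ x).nom = none → x ≠ v → (σ y).nom ≠ none →
    (τ y).tok ≠ none

lemma complainSpec {σ τ : Config n} {v : ZMod n} {L : Set (ZMod n)} {help : Prop}
    {del : Finset (ZMod n × ZMod n)} (hg : Good σ) (hv : Nominated σ v)
    (h : ∀ u, τ u = next (complain L help) (σ u) (inbox σ del u)) :
    ComplainSpec σ τ v del := by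
  have hn : ∀ u, (τ u).nom = adopt Reg.nom (σ u) (inbox σ del u) := fun u => by
    rw [h, next_nom (fun _ _ => rfl) hg]
  refine ⟨fun {u} hu => ?_, fun u w hu => ?_, fun u => ?_, fun {y x} hx => ?_,
    fun {x y} hxy hx hxv hy => ?_⟩
  · rw [hn, adopt_of_some (hv.nom_eq hu)]
    simp
  · rw [hn] at hu
    rcases adopt_eq_some hu with h | ⟨-, z, -, h⟩ <;> exact hv _ _ h
  · rw [h]
    by_cases hl : learn (σ u) (inbox σ del u) = none
    · rw [next_of_learn_eq_none hl]
      rfl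
    · rw [next_of_learn hl]
      rfl
  · rw [h] at hx
    by_cases hl : learn (σ y) (inbox σ del y) = none
    · rw [next_of_learn_eq_none hl] at hx
      cases hx
    · rw [next_of_learn hl] at hx
      obtain ⟨w, p, hw, hp, hxw, q, ⟨u, -, rfl⟩, hq, rfl⟩ := mem_of_pick hx
      have hpy := hg.pos_of_nom (v := y) (by simp [hw])
      rw [hpy] at hp
      cases hp
      rw [hv _ _ hw] at hxw
      refine ⟨by simp [hw], ?_, hxw⟩
      simpa using hq
  · have hp := hg.pos_of_nom hy
    have hl : learn (σ y) (inbox σ del y) ≠ none := learn_ne_none_of_pos (by rw [hp]; simp)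
    rw [h, next_of_learn hl]
    exact pick_ne_none (x := x)
      ⟨v, y, hv.nom_eq hy, hp, hxv, (x - y, σ x), ⟨x, hxy, rfl⟩, hx, by simp⟩

lemma ComplainSpec.spreading {σ τ : Config n} {v : ZMod n} {del : Finset (ZMod n × ZMod n)}
    (h : ComplainSpec σ τ v del) (hg : Good τ) : Spreading τ :=
  ⟨hg, fun {u w} hu => by rw [h.known] at hu; exact hu.elim⟩

/-- What `report` achieves in any case. -/
structure ReportSpec (σ σ' : Config n) (v : ZMod n) : Prop where
  nom_keep : ∀ {u}, (σ u).nom ≠ none → (σ' u).nom ≠ none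
  nominated : Nominated σ' v
  tok_spec : ∀ {y x}, (σ' y).tok = some x → (σ x).nom = none ∧ x ≠ v

section
variable [NeZero n]

lemma Step.extends {α : ℝ} {op : Op n} (hop : Adopting op) {σ τ : Config n} (hg : Good σ)
    (h : Step α op σ τ) : Extends σ τ := by
  obtain ⟨del, -, h⟩ := h
  exact hop.extends_next hg h

lemma ComplainSpec.reportSpec {α : ℝ} {R : ℕ} {σ τ σ' : Config n} {v : ZMod n}
    {del : Finset (ZMod n × ZMod n)} (h : ComplainSpec σ τ v del) (hg : Good τ)
    (h' : Exec α (spread R ++ [target]) τ σ') : ReportSpec σ σ' v := by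
  obtain ⟨ρ, h1, ρ', h2, h3⟩ := exec_append.1 h'
  cases h3
  obtain ⟨e1, hs⟩ := (h.spreading hg).exec h1
  have e := e1.trans (h2.extends adopting_target hs.good)
  refine ⟨fun hu => e.nom_ne_none (h.nom_keep hu), e.nominated h.nominated, fun hx => ?_⟩
  obtain ⟨w, hw⟩ := e.tok_source hx
  exact (h.tok_spec hw).2

lemma report_spec {α : ℝ} {R : ℕ} {L : Set (ZMod n)} {help : Prop} {σ σ' : Config n} {v : ZMod n}
    (hg : Good σ) (hv : Nominated σ v) (h : Exec α (report R L help) σ σ') :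
    ReportSpec σ σ' v := by
  obtain ⟨τ, h1, h2⟩ := h
  have hgτ := h1.good hg
  obtain ⟨del, -, h1⟩ := h1
  exact (complainSpec hg hv h1).reportSpec hgτ h2

/-- If a complaint gets through to a vertex that knows the nominee `v`, then `v` gets a token, or
some vertex hears of the nominee for the first time: in the last step almost all vertices send both
to `v` and to a vertex that has complained. The latter need not be the same for all senders. -/
lemma ComplainSpec.progress {α : ℝ} (hα : 1 / 2 ≤ α) (hα1 : α < 1) (hn : 2 ≤ n) {c : ℕ}
    (hc : 1 / (α * (1 - α) ^ 2) ≤ c) (hcn : 2 * c ≤ n + 1) {R : ℕ} (hR : decay α ^ R * n ≤ 1)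
    {σ τ σ' : Config n} {v : ZMod n} {del : Finset (ZMod n × ZMod n)}
    (h : ComplainSpec σ τ v del) (hg : Good τ)
    (hdel : ∃ x y, (x, y) ∈ del ∧ (σ x).nom = none ∧ x ≠ v ∧ (σ y).nom ≠ none)
    (h' : Exec α (spread (R + 2) ++ [target]) τ σ') :
    (σ' v).tok ≠ none ∨ ∃ x, (σ x).nom = none ∧ (σ' x).nom ≠ none := by
  obtain ⟨x₀, y₀, hxy, hx₀, hxv, hy₀⟩ := hdel
  obtain ⟨ρ, h1, ρ', h2, h3⟩ := exec_append.1 h'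
  cases h3
  have hcard := (h.spreading hg).card_tokenless_le hα hα1 hn hc hR
    ⟨y₀, h.tok_of_mem hxy hx₀ hxv hy₀⟩ h1
  obtain ⟨e1, hs⟩ := (h.spreading hg).exec h1
  have e2 := h2.extends adopting_target hs.good
  by_contra! hcon
  obtain ⟨hv, hcon⟩ := hcon
  have hσ' : ∀ {x}, (σ x).nom = none → (ρ x).nom = none := fun {x} hx => by
    by_contra hc
    exact e2.nom_ne_none hc (hcon x hx)
  have hvρ : (ρ v).tok = none := by
    by_contra hc
    exact e2.tok_ne_none hc hv
  have hnt : ∀ {u}, (ρ u).tok ≠ none → (ρ u).nom = some v := fun {u} hu =>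
    (e1.nominated h.nominated).nom_eq
      (e1.nom_of_tok (fun u hu => by
        obtain ⟨x, hx⟩ := Option.ne_none_iff_exists'.1 hu
        exact h.nom_keep (h.tok_spec hx).1) u hu)
  have htx : ∀ {u x}, (ρ u).tok = some x → (σ x).nom = none ∧ x ≠ v := fun {u x} hx => by
    obtain ⟨w, hw⟩ := e1.tok_source hx
    exact (h.tok_spec hw).2
  -- The two messages of every token holder are distinct, and none is sent to the holder itself.
  set H := (tokenless ρ)ᶜ with hH
  have memH : ∀ {u}, u ∈ H ↔ (ρ u).tok ≠ none := by simp [hH]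
  have hsub : H.image (fun u => (u, v)) ∪ H.image (fun u => (u, ((ρ u).tok).getD 0))
      ⊆ sent target ρ := by
    intro a ha
    rw [mem_union, mem_image, mem_image] at ha
    rcases ha with ⟨u, hu, rfl⟩ | ⟨u, hu, rfl⟩
    · rw [memH] at hu
      rw [mem_sent]
      refine ⟨?_, hu, u, hs.good.pos_of_tok hu, Or.inr ?_⟩
      · rintro rfl
        exact hu hvρ
      · rw [hnt hu]
        simp
    · rw [memH] at hu
      obtain ⟨x, hx⟩ := Option.ne_none_iff_exists'.1 hu
      rw [mem_sent, hx, Option.getD_some]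
      refine ⟨?_, hu, u, hs.good.pos_of_tok hu, Or.inl (hx.trans ?_)⟩
      · rintro rfl
        have h5 := hσ' (htx hx).1
        rw [hnt hu] at h5
        cases h5
      · simp
  have hle : n ≤ (sent target ρ).card + 1 := by
    have h5 := card_le_card hsub
    rw [card_union_of_disjoint, card_image_of_injective _ (fun a b hab => (Prod.ext_iff.1 hab).1),
      card_image_of_injective _ (fun a b hab => (Prod.ext_iff.1 hab).1)] at h5
    · have := card_tokenless_add ρ
      rw [← hH] at this
      omega
    · rw [Finset.disjoint_left]
      intro a ha hb
      rw [mem_image] at ha hb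
      obtain ⟨u, -, rfl⟩ := ha
      obtain ⟨w, hw, hab⟩ := hb
      rw [memH] at hw
      obtain ⟨x, hx⟩ := Option.ne_none_iff_exists'.1 hw
      have h6 := (Prod.ext_iff.1 hab).2
      simp only [hx, Option.getD_some] at h6
      exact (htx hx).2 h6
  obtain ⟨del', hdel', h2⟩ := h2
  obtain ⟨⟨u, w⟩, ha, ha'⟩ := hdel'.exists_mem_of_card hα1 hn hle
  obtain ⟨-, hu, p, hp, hw⟩ := mem_sent.1 ha
  rw [hs.good.pos_of_tok hu] at hp
  cases hp
  rw [add_sub_cancel] at hw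
  rcases hw with hw | hw
  · refine absurd (hcon w (htx hw).1) ?_
    rw [h2, next_nom (fun _ _ => rfl) hs.good]
    exact adopt_ne_none_of_mem ha' (by rw [hnt hu]; simp)
  · rw [hnt hu] at hw
    cases hw
    refine absurd hv ?_
    rw [h2, next_tok (fun _ _ => rfl) hs.good]
    exact adopt_ne_none_of_mem ha' hu

open Classical in
/-- The vertices that know of no nominee. -/
noncomputable def unaware (σ : Config n) : Finset (ZMod n) :=
  univ.filter fun v => (σ v).nom = none

@[simp] lemma mem_unaware {σ : Config n} {v : ZMod n} :
    v ∈ unaware σ ↔ (σ v).nom = none := by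
  simp [unaware]

lemma ReportSpec.unaware_subset {σ σ' : Config n} {v : ZMod n} (h : ReportSpec σ σ' v) :
    unaware σ' ⊆ unaware σ := by
  intro u hu
  rw [mem_unaware] at hu ⊢
  by_contra hc
  exact h.nom_keep hc hu

section
variable {α : ℝ} (hα : 1 / 2 ≤ α) (hα1 : α < 1) {c : ℕ} (hc : 1 / (α * (1 - α) ^ 2) ≤ c)
  (hcn : c * (c + 2) + 1 < (1 - α) * n) {R : ℕ} (hR : decay α ^ R * n ≤ 1)
include hα hα1 hc hcn hR

/-- A report for an uninformed nominee `v`: it informs some vertex, or makes some vertex learn the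
nominee. Those who know of no nominee send constantly many complaints each, all others send to
`v`. This is too much for the adversary to stop, apart from the complaints of `v` itself. -/
lemma report_progress {L : Finset (ZMod n)} (hL : L.card = c + 2) (hL0 : 0 ∉ L) {σ σ' : Config n}
    {v : ZMod n} (hg : Good σ) (hv : Nominated σ v) (hvi : (σ v).pos = none)
    (hN : (unaware σ).card ≤ c) (h : Exec α (report (R + 2) L True) σ σ') :
    (uninformed σ').card < (uninformed σ).card ∨ (unaware σ').card < (unaware σ).card := by
  have hcn1 : 2 * c + 1 ≤ n := by
    have h1 : (c : ℝ) * (c + 2) + 1 < n / 2 := by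
      have : (0 : ℝ) ≤ n := by positivity
      nlinarith
    have h2 : (2 * c + 1 : ℝ) ≤ n := by nlinarith [sq_nonneg (c : ℝ)]
    exact_mod_cast h2
  have hc1 : 1 ≤ c := by
    have : (0 : ℝ) < c := lt_of_lt_of_le (by
      have : 0 < 1 - α := by linarith
      positivity) hc
    exact_mod_cast this
  have hspec := report_spec hg hv h
  have hex := h
  obtain ⟨τ, h1, h2⟩ := h
  have hgτ := h1.good hg
  have hgσ' := Exec.good h2 hgτ
  have hstep := h1
  obtain ⟨del, hdel, h1⟩ := h1
  have hcs := complainSpec hg hv h1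
  have hvn : (σ v).nom = none := by rw [hg.eq_blank hvi]; rfl
  -- Every unaware vertex has a complaint label that leads to an aware vertex.
  have hlab : ∀ u : ZMod n, ∃ ℓ ∈ L, (σ (u + ℓ)).nom ≠ none := by
    intro u
    by_contra! hcon
    have h3 : L.image (fun ℓ => u + ℓ) ⊆ unaware σ := by
      intro w hw
      obtain ⟨ℓ, hℓ, rfl⟩ := mem_image.1 hw
      exact mem_unaware.2 (hcon ℓ hℓ)
    have h4 := card_le_card h3
    rw [card_image_of_injective _ (add_right_injective u), hL] at h4
    omega
  choose lab hlabL hlab using hlab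
  classical
  set g : ZMod n → ZMod n := fun u => if (σ u).nom = none then u + lab u else v with hg_def
  set Q := (univ.erase v).image fun u => (u, g u) with hQ_def
  have hQc : Q.card = n - 1 := by
    rw [hQ_def, card_image_of_injective _ (fun a b hab => (Prod.ext_iff.1 hab).1),
      card_erase_of_mem (mem_univ _), card_univ, ZMod.card]
  have hQ : Q ⊆ sent (complain L True) σ := by
    intro a ha
    obtain ⟨u, hu, rfl⟩ := mem_image.1 ha
    rw [mem_sent]
    by_cases hun : (σ u).nom = none
    · have : g u = u + lab u := by simp [hg_def, hun]
      rw [this, add_sub_cancel_left]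
      refine ⟨fun h => hL0 ?_, Or.inl ⟨hun, hlabL u⟩⟩
      have : lab u = 0 := by simpa using h.symm
      rw [← this]
      exact hlabL u
    · have : g u = v := by simp [hg_def, hun]
      rw [this]
      exact ⟨ne_of_mem_erase hu, Or.inr ⟨trivial, u, v, hg.pos_of_nom hun, hv.nom_eq hun, by simp⟩⟩
  have hS : (sent (complain L True) σ).card ≤ n + c * (c + 2) := by
    have hsub : sent (complain L True) σ ⊆
        univ.image (fun u => (u, v)) ∪ (unaware σ ×ˢ L).image (fun a => (a.1, a.1 + a.2)) := by
      rintro ⟨u, w⟩ h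
      rw [mem_union, mem_image, mem_image]
      rcases (mem_sent.1 h).2 with ⟨h3, h4⟩ | ⟨-, p, v', hp, hv', hw⟩
      · exact Or.inr ⟨(u, w - u), mem_product.2 ⟨mem_unaware.2 h3, by exact_mod_cast h4⟩, by simp⟩
      · left
        rw [hg.pos_of_nom (by simp [hv'])] at hp
        cases hp
        refine ⟨u, mem_univ _, ?_⟩
        rw [← hv _ _ hv', ← hw, add_sub_cancel]
    refine (card_le_card hsub).trans ((card_union_le _ _).trans (add_le_add ?_ ?_))
    · refine card_image_le.trans ?_
      rw [card_univ, ZMod.card]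
    · refine card_image_le.trans ?_
      rw [card_product, hL]
      gcongr
  obtain ⟨a, ha, had⟩ := hdel.exists_mem hQ (by omega) (by
    have hS' : ((sent (complain L True) σ).card : ℝ) ≤ n + c * (c + 2) := by exact_mod_cast hS
    have h3 : α * (sent (complain L True) σ).card ≤ α * (n + c * (c + 2)) := by gcongr
    have h4 : (Q.card : ℝ) = n - 1 := by
      rw [hQc, Nat.cast_sub (by omega)]
      simp
    have h5 : α * (c * (c + 2)) ≤ 1 * ((c : ℝ) * (c + 2)) := by gcongr
    rw [h4]
    linarith)
  obtain ⟨u, hu, rfl⟩ := mem_image.1 ha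
  by_cases hun : (σ u).nom = none
  · have hgu : g u = u + lab u := by simp [hg_def, hun]
    rw [hgu] at had
    rcases hcs.progress hα hα1 (by omega) hc (by omega) hR hgτ
      ⟨u, _, had, hun, ne_of_mem_erase hu, hlab u⟩ h2 with h3 | ⟨x, hx, hx'⟩
    · left
      exact Exec.uninformed_card_lt hex hvi (by rw [hgσ'.pos_of_tok h3]; simp)
    · right
      exact card_lt_card ⟨hspec.unaware_subset, fun hs =>
        hx' (mem_unaware.1 (hs (mem_unaware.2 hx)))⟩
  · left
    have hgu : g u = v := by simp [hg_def, hun]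
    rw [hgu] at had
    refine Exec.uninformed_card_lt hex hvi (Exec.pos_mono h2 ?_)
    rw [h1, next_pos]
    exact learn_ne_none_of_mem had (by rw [hg.pos_of_nom hun]; simp)

/-- A report with the initiator as nominee, where exactly the uninformed vertices complain, to
everybody: it informs some vertex, or the initiator gets a token. -/
lemma report_zero_progress {σ σ' : Config n} (hg : Good σ) (hv : Nominated σ 0)
    (hnom : ∀ u, (σ u).nom = none ↔ (σ u).pos = none) (h0 : (σ 0).pos ≠ none)
    (hU : (uninformed σ).Nonempty) (hUc : (uninformed σ).card ≤ c)
    (h : Exec α (report (R + 2) Set.univ False) σ σ') :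
    (uninformed σ').card < (uninformed σ).card ∨ (σ' 0).tok ≠ none := by
  have hcn1 : 2 * c + 1 ≤ n := by
    have h1 : (c : ℝ) * (c + 2) + 1 < n / 2 := by
      have : (0 : ℝ) ≤ n := by positivity
      nlinarith
    have h2 : (2 * c + 1 : ℝ) ≤ n := by nlinarith [sq_nonneg (c : ℝ)]
    exact_mod_cast h2
  have hU1 : 1 ≤ (uninformed σ).card := card_pos.2 hU
  have hex := h
  obtain ⟨τ, h1, h2⟩ := h
  have hgτ := h1.good hg
  have hgσ' := Exec.good h2 hgτ
  obtain ⟨del, hdel, h1⟩ := h1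
  have hcs := complainSpec hg hv h1
  classical
  have hsum : (uninformed σ).card + (uninformed σ)ᶜ.card = n := by
    rw [card_add_card_compl, ZMod.card]
  have hQ : uninformed σ ×ˢ (uninformed σ)ᶜ ⊆ sent (complain Set.univ False) σ := by
    rintro ⟨u, w⟩ h
    rw [mem_product, mem_compl, mem_uninformed, mem_uninformed] at h
    rw [mem_sent]
    refine ⟨?_, Or.inl ⟨(hnom u).2 h.1, Set.mem_univ _⟩⟩
    rintro rfl
    exact h.2 h.1
  have hS : (sent (complain Set.univ False) σ).card ≤ (uninformed σ).card * (n - 1) := by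
    have hsub : sent (complain Set.univ False) σ ⊆
        (uninformed σ).biUnion fun u => (univ.erase u).image fun w => (u, w) := by
      rintro ⟨u, w⟩ h
      rw [mem_sent] at h
      simp only [mem_biUnion, mem_uninformed, mem_image, mem_erase, mem_univ, and_true]
      refine ⟨u, ?_, w, h.1.symm, rfl⟩
      rcases h.2 with ⟨h, -⟩ | ⟨h, -⟩
      exacts [(hnom u).1 h, h.elim]
    refine (card_le_card hsub).trans (card_biUnion_le_card_mul _ _ _ fun u _ => ?_)
    refine card_image_le.trans ?_
    rw [card_erase_of_mem (mem_univ _), card_univ, ZMod.card]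
  obtain ⟨⟨u, w⟩, ha, had⟩ := hdel.exists_mem hQ (by
    rw [card_product]
    have h3 : 1 ≤ (uninformed σ)ᶜ.card := by omega
    obtain ⟨a, ha⟩ := Nat.exists_eq_add_of_le hU1
    obtain ⟨b, hb⟩ := Nat.exists_eq_add_of_le h3
    rw [ha, hb] at hsum ⊢
    nlinarith [Nat.zero_le (a * b)]) (by
    have hS' : ((sent (complain Set.univ False) σ).card : ℝ) ≤ (uninformed σ).card * n := by
      have := hS.trans (Nat.mul_le_mul_left _ (Nat.sub_le n 1))
      exact_mod_cast this
    rw [card_product]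
    push_cast
    have hU1' : (1 : ℝ) ≤ (uninformed σ).card := by exact_mod_cast hU1
    have hUc' : ((uninformed σ).card : ℝ) ≤ c := by exact_mod_cast hUc
    have hsum' : ((uninformed σ).card : ℝ) + (uninformed σ)ᶜ.card = n := by exact_mod_cast hsum
    have hα0 : 0 ≤ α := by linarith
    have hlt : α * n < (uninformed σ)ᶜ.card := by nlinarith [sq_nonneg (c : ℝ)]
    calc α * (sent (complain Set.univ False) σ).card ≤ α * ((uninformed σ).card * n) := by gcongr
      _ = (uninformed σ).card * (α * n) := by ring
      _ < (uninformed σ).card * (uninformed σ)ᶜ.card := by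
          apply mul_lt_mul_of_pos_left hlt
          linarith)
  rw [mem_product, mem_compl, mem_uninformed, mem_uninformed] at ha
  rcases hcs.progress hα hα1 (by omega) hc (by omega) hR hgτ
    ⟨u, w, had, (hnom u).2 ha.1, fun h => h0 (h ▸ ha.1), fun h => ha.2 ((hnom w).1 h)⟩ h2 with
    h3 | ⟨x, hx, hx'⟩
  · exact Or.inr h3
  · left
    exact Exec.uninformed_card_lt hex ((hnom x).1 hx) (by rw [hgσ'.pos_of_nom hx']; simp)

end

end

/-! ### The protocol for large networks -/

/-- A step without messages, in which the memory is changed by `f`. -/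
def silent (f : Reg n → Reg n) : Op n where
  sends _ _ := False
  act r _ := f r

/-- The initiator becomes the nominee. -/
def nominateZero (r : Reg n) : Reg n := { r with nom := some 0, tok := none }

open Classical in
/-- All tokens but that of the initiator are discarded. -/
noncomputable def keepZero (r : Reg n) : Reg n :=
  ⟨r.pos, none, if r.pos = some 0 then r.tok else none, ∅, ∅⟩

/-- The tokens become nominees. -/
def promote (r : Reg n) : Reg n := ⟨r.pos, r.tok, none, ∅, ∅⟩

/-- A sequence of reports for the current nominee. -/
noncomputable def reports (R : ℕ) (L : Set (ZMod n)) : ℕ → List (Op n)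
  | 0 => []
  | k + 1 => report R L True ++ reports R L k

/-- The initiator gets hold of the name of an uninformed vertex, this vertex is announced as the
nominee, and then helped by `k` reports. -/
noncomputable def rescue (R : ℕ) (L : Set (ZMod n)) (k : ℕ) : List (Op n) :=
  silent nominateZero :: (report R Set.univ False ++
    (silent keepZero :: (spread R ++ (silent promote :: reports R L k))))

/-- A sequence of rescues. -/
noncomputable def rescues (R : ℕ) (L : Set (ZMod n)) (k : ℕ) : ℕ → List (Op n)
  | 0 => []
  | j + 1 => rescue R L k ++ rescues R L k j

lemma length_report (R : ℕ) (L : Set (ZMod n)) (help : Prop) :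
    (report R L help).length = 2 * R + 2 := by
  simp [report, length_spread]

lemma length_reports (R : ℕ) (L : Set (ZMod n)) (k : ℕ) :
    (reports R L k).length = k * (2 * R + 2) := by
  induction k with
  | zero => simp [reports]
  | succ k ih =>
    simp only [reports, List.length_append, ih, length_report]
    ring

lemma length_rescues (R : ℕ) (L : Set (ZMod n)) (k j : ℕ) :
    (rescues R L k j).length = j * ((k + 2) * (2 * R + 2) + 1) := by
  induction j with
  | zero => simp [rescues]
  | succ j ih =>
    simp only [rescues, rescue, List.length_append, List.length_cons, ih, length_report,
      length_reports, length_spread]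
    ring

/-- The start: only the initiator has the information, and it holds a token. -/
noncomputable def initial (n : ℕ) : Config n :=
  fun v => open Classical in if v = 0 then ⟨some 0, none, some 0, ∅, ∅⟩ else blank

lemma initial_zero : (initial n) 0 = ⟨some 0, none, some 0, ∅, ∅⟩ := by
  simp [initial]

lemma good_initial : Good (initial n) := by
  intro v
  by_cases hv : v = 0
  · subst hv
    left
    rw [initial_zero]
  · right
    simp [initial, hv]

lemma spreading_initial : Spreading (initial n) := by
  refine ⟨good_initial, fun {u w} h => ?_⟩
  by_cases hu : u = 0
  · subst hu
    rw [initial_zero] at h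
    exact h.elim
  · have : initial n u = blank := by simp [initial, hu]
    rw [this] at h
    exact h.elim

section
variable [NeZero n] {α : ℝ}

lemma Step.silent_apply {f : Reg n → Reg n} {σ τ : Config n} (hg : Good σ)
    (h : Step α (silent f) σ τ) (v : ZMod n) :
    ((σ v).pos ≠ none → τ v = { f (σ v) with pos := some v }) ∧
      ((σ v).pos = none → τ v = blank) := by
  obtain ⟨del, hdel, h⟩ := h
  have hempty : ∀ {u}, (u, v) ∉ del := fun hu => (mem_sent.1 (hdel.1 hu)).2
  have hl : learn (σ v) (inbox σ del v) = (σ v).pos := by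
    unfold learn
    cases hp : pick {x | ∃ p ∈ inbox σ del v, ∃ z, p.2.pos = some z ∧ x = z - p.1} with
    | none => simp
    | some x =>
      obtain ⟨p, ⟨u, hu, -⟩, -⟩ := mem_of_pick hp
      exact absurd hu hempty
  constructor
  · intro hv
    rw [h, next_of_learn (by rwa [hl]), hl, hg.pos_eq hv]
    rfl
  · intro hv
    rw [h, next_of_learn_eq_none (by rw [hl, hv])]

variable (hα : 1 / 2 ≤ α) (hα1 : α < 1) {c : ℕ} (hc : 1 / (α * (1 - α) ^ 2) ≤ c)
  (hcn : c * (c + 2) + 1 < (1 - α) * n) {R : ℕ} (hR : decay α ^ R * n ≤ 1)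
  {L : Finset (ZMod n)} (hL : L.card = c + 2) (hL0 : 0 ∉ L)
include hα hα1 hc hcn hR

include hL hL0 in
/-- As long as nobody is informed, each report decreases the number of those who do not know the
nominee. -/
lemma reports_progress {k : ℕ} {σ σ' : Config n} {v : ZMod n} (hg : Good σ) (hv : Nominated σ v)
    (hvi : (σ v).pos = none) (hN : (unaware σ).card ≤ c)
    (h : Exec α (reports (R + 2) L k) σ σ') :
    (uninformed σ').card < (uninformed σ).card ∨
      (unaware σ').card + k ≤ (unaware σ).card := by
  induction k generalizing σ with
  | zero =>
    cases h
    exact Or.inr le_rfl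
  | succ k ih =>
    obtain ⟨τ, h1, h2⟩ := exec_append.1 h
    have hle1 := card_le_card h1.uninformed_subset
    have hle2 := card_le_card h2.uninformed_subset
    by_cases hvτ : (τ v).pos = none
    · have hspec := report_spec hg hv h1
      rcases report_progress hα hα1 hc hcn hR hL hL0 hg hv hvi hN h1 with h3 | h3
      · left
        omega
      · rcases ih (h1.good hg) hspec.nominated hvτ (by omega) h2 with h4 | h4
        · left
          omega
        · right
          omega
    · left
      have := h1.uninformed_card_lt hvi hvτ
      omega

include hL hL0 in
lemma rescue_progress {σ σ' : Config n} (hg : Good σ) (h0 : (σ 0).pos ≠ none)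
    (hU : (uninformed σ).Nonempty) (hUc : (uninformed σ).card ≤ c)
    (h : Exec α (rescue (R + 2) L (c + 1)) σ σ') :
    (uninformed σ').card < (uninformed σ).card := by
  have hn : 2 ≤ n := by
    have h1 : (1 : ℝ) < n := by nlinarith [sq_nonneg (c : ℝ), (Nat.cast_nonneg c : (0 : ℝ) ≤ c)]
    exact_mod_cast h1
  obtain ⟨σ₁, h1, h⟩ := h
  obtain ⟨σ₂, h2, σ₃, h3, h⟩ := exec_append.1 h
  obtain ⟨σ₄, h4, σ₅, h5, h6⟩ := exec_append.1 h
  have hg1 := h1.good hg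
  have hg2 := h2.good hg1
  have hg3 := h3.good hg2
  have hg4 := h4.good hg3
  have hg5 := h5.good hg4
  have l1 := card_le_card h1.exec.uninformed_subset
  have l2 := card_le_card h2.uninformed_subset
  have l3 := card_le_card h3.exec.uninformed_subset
  have l4 := card_le_card h4.uninformed_subset
  have l5 := card_le_card h5.exec.uninformed_subset
  have l6 := card_le_card h6.uninformed_subset
  -- Suppose that nobody is informed; then `σ` to `σ₅` have the same uninformed vertices.
  by_contra! hcon
  have hnom1 : ∀ u, (σ₁ u).nom = none ↔ (σ₁ u).pos = none := by
    intro u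
    by_cases hu : (σ u).pos = none
    · rw [(h1.silent_apply hg u).2 hu]
      simp [blank]
    · rw [(h1.silent_apply hg u).1 hu]
      simp [nominateZero]
  have hv1 : Nominated σ₁ 0 := by
    intro u w hw
    by_cases hu : (σ u).pos = none
    · rw [(h1.silent_apply hg u).2 hu] at hw
      cases hw
    · rw [(h1.silent_apply hg u).1 hu] at hw
      simpa [nominateZero] using hw.symm
  have hU1 : (uninformed σ₁).Nonempty := by
    have := card_pos.2 hU
    rw [← card_pos]
    omega
  rcases report_zero_progress hα hα1 hc hcn hR hg1 hv1 hnom1 (h1.pos_mono h0) hU1 (by omega) h2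
    with h7 | h7
  · omega
  obtain ⟨v, hv⟩ := Option.ne_none_iff_exists'.1 h7
  have hvi1 : (σ₁ v).pos = none := (hnom1 v).1 ((report_spec hg1 hv1 h2).tok_spec hv).1
  -- The token of the initiator is now the only one, and it names an uninformed vertex.
  have htok3 : (σ₃ 0).tok = some v := by
    have hp := hg2.pos_of_tok h7
    rw [(h3.silent_apply hg2 0).1 (by simp [hp])]
    simp [keepZero, hp, hv]
  have htok3' : ∀ u w, (σ₃ u).tok = some w → w = v := by
    intro u w hw
    by_cases hu : (σ₂ u).pos = none
    · rw [(h3.silent_apply hg2 u).2 hu] at hw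
      cases hw
    · rw [(h3.silent_apply hg2 u).1 hu] at hw
      simp only [keepZero, hg2.pos_eq hu, Option.some.injEq] at hw
      split_ifs at hw with hu0
      subst hu0
      rw [hv] at hw
      exact (Option.some.inj hw).symm
  have hs3 : Spreading σ₃ := by
    refine ⟨hg3, fun {u w} hw => ?_⟩
    by_cases hu : (σ₂ u).pos = none
    · rw [(h3.silent_apply hg2 u).2 hu] at hw
      exact hw.elim
    · rw [(h3.silent_apply hg2 u).1 hu] at hw
      exact hw.elim
  have hcard := hs3.card_tokenless_le hα hα1 hn hc hR ⟨0, by simp [htok3]⟩ h4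
  have hext := (hs3.exec h4).1
  -- The tokens have become nominees.
  have hnom5 : ∀ u, (σ₅ u).nom = (σ₄ u).tok := by
    intro u
    by_cases hu : (σ₄ u).pos = none
    · rw [(h5.silent_apply hg4 u).2 hu, hg4.eq_blank hu]
      rfl
    · rw [(h5.silent_apply hg4 u).1 hu]
      rfl
  have hv5 : Nominated σ₅ v := by
    intro u w hw
    rw [hnom5] at hw
    obtain ⟨z, hz⟩ := hext.tok_source hw
    exact htok3' z w hz
  have hN5 : (unaware σ₅).card ≤ c := by
    refine le_trans (card_le_card fun u hu => ?_) hcard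
    rw [mem_unaware, hnom5] at hu
    rwa [mem_tokenless]
  have hvi5 : (σ₅ v).pos = none := by
    by_contra hvi
    have hex : Exec α (report (R + 2) Set.univ False ++
        (silent keepZero :: (spread (R + 2) ++ [silent promote]))) σ₁ σ₅ :=
      exec_append.2 ⟨σ₂, h2, σ₃, h3, exec_append.2 ⟨σ₄, h4, h5.exec⟩⟩
    have := hex.uninformed_card_lt hvi1 hvi
    omega
  rcases reports_progress hα hα1 hc hcn hR hL hL0 hg5 hv5 hvi5 hN5 h6 with h8 | h8 <;> omega

include hL hL0 in
lemma rescues_progress {k : ℕ} {σ σ' : Config n} (hg : Good σ) (h0 : (σ 0).pos ≠ none)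
    (hUc : (uninformed σ).card ≤ c) (h : Exec α (rescues (R + 2) L (c + 1) k) σ σ') :
    (uninformed σ').card ≤ (uninformed σ).card - k := by
  induction k generalizing σ with
  | zero =>
    cases h
    exact le_rfl
  | succ k ih =>
    obtain ⟨τ, h1, h2⟩ := exec_append.1 h
    have hle := card_le_card h1.uninformed_subset
    have h3 := ih (h1.good hg) (h1.pos_mono h0) (by omega) h2
    rcases (uninformed σ).eq_empty_or_nonempty with hU | hU
    · rw [hU, card_empty] at hle ⊢
      omega
    · have := rescue_progress hα hα1 hc hcn hR hL hL0 hg h0 hU hUc h1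
      omega

include hL hL0 in
/-- In large networks the program, of logarithmic length, informs everybody. -/
theorem pos_ne_none_of_large {σ : Config n}
    (h : Exec α (spread (R + 2) ++ rescues (R + 2) L (c + 1) c) (initial n) σ) (v : ZMod n) :
    (σ v).pos ≠ none := by
  have hn : 2 ≤ n := by
    have h1 : (1 : ℝ) < n := by nlinarith [sq_nonneg (c : ℝ), (Nat.cast_nonneg c : (0 : ℝ) ≤ c)]
    exact_mod_cast h1
  obtain ⟨τ, h1, h2⟩ := exec_append.1 h
  have hcard := spreading_initial.card_tokenless_le hα hα1 hn hc hR
    ⟨0, by rw [initial_zero]; simp⟩ h1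
  have hg := h1.good good_initial
  have hU : (uninformed τ).card ≤ c := by
    refine le_trans (card_le_card fun u hu => ?_) hcard
    rw [mem_uninformed] at hu
    rw [mem_tokenless, hg.eq_blank hu]
    rfl
  have h3 := rescues_progress hα hα1 hc hcn hR hL hL0 hg
    (h1.pos_mono (by rw [initial_zero]; simp)) hU h2
  have h4 : (uninformed σ).card = 0 := by omega
  intro hv
  rw [card_eq_zero] at h4
  exact Finset.notMem_empty v (h4 ▸ mem_uninformed.2 hv)

end

/-! ### The protocol for small networks -/

/-- Every vertex with the information sends it to the set `U`. -/
noncomputable def toSet (U : Finset (ZMod n)) : Op n where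
  sends r ℓ := ∃ p, r.pos = some p ∧ p + ℓ ∈ U
  act _ _ := blank

section
variable [NeZero n] {α : ℝ}

/-- If `U` is the uninformed set, then at least `n - 1` messages are sent, so that not all of them
can be destroyed. -/
lemma toSet_progress (hα1 : α < 1) (hn : 2 ≤ n) {σ σ' : Config n} (hg : Good σ)
    (h0 : (σ 0).pos ≠ none) (hU : (uninformed σ).Nonempty)
    (h : Step α (toSet (uninformed σ)) σ σ') :
    (uninformed σ').card < (uninformed σ).card := by
  have hex := h.exec
  obtain ⟨del, hdel, h⟩ := h
  have hsub : (uninformed σ)ᶜ ×ˢ uninformed σ ⊆ sent (toSet (uninformed σ)) σ := by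
    rintro ⟨u, w⟩ hu
    rw [mem_product, mem_compl, mem_uninformed] at hu
    rw [mem_sent]
    refine ⟨?_, u, hg.pos_eq hu.1, by simpa using hu.2⟩
    rintro rfl
    exact hu.1 (mem_uninformed.1 hu.2)
  have hle : n ≤ (sent (toSet (uninformed σ)) σ).card + 1 := by
    have h1 := card_le_card hsub
    rw [card_product] at h1
    have h2 : (uninformed σ).card + (uninformed σ)ᶜ.card = n := by
      rw [card_add_card_compl, ZMod.card]
    have h3 : 1 ≤ (uninformed σ).card := card_pos.2 hU
    have h4 : 1 ≤ (uninformed σ)ᶜ.card := card_pos.2 ⟨0, by simpa using h0⟩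
    obtain ⟨a, ha⟩ := Nat.exists_eq_add_of_le h3
    obtain ⟨b, hb⟩ := Nat.exists_eq_add_of_le h4
    rw [ha, hb] at h1 h2
    nlinarith [Nat.zero_le (a * b)]
  obtain ⟨⟨u, w⟩, ha, had⟩ := hdel.exists_mem_of_card hα1 hn hle
  obtain ⟨-, p, hp, hw⟩ := mem_sent.1 ha
  have hpu := hg.pos_eq (v := u) (by simp [hp])
  rw [hpu] at hp
  cases hp
  rw [add_sub_cancel, mem_uninformed] at hw
  refine hex.uninformed_card_lt hw ?_
  rw [h, next_pos]
  exact learn_ne_none_of_mem had (by simp [hpu])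

variable (n) in
/-- `k` passes through all sets of vertices. -/
noncomputable def sweeps : ℕ → List (Op n)
  | 0 => []
  | k + 1 => (univ : Finset (Finset (ZMod n))).toList.map toSet ++ sweeps k

/-- A pass comes to the set that was uninformed at its start, so that it cannot leave this set
unchanged. -/
lemma sweeps_progress (hα1 : α < 1) (hn : 2 ≤ n) {k : ℕ} {σ σ' : Config n} (hg : Good σ)
    (h0 : (σ 0).pos ≠ none) (h : Exec α (sweeps n k) σ σ') :
    (uninformed σ').card ≤ (uninformed σ).card - k := by
  induction k generalizing σ with
  | zero =>
    cases h
    exact le_rfl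
  | succ k ih =>
    obtain ⟨τ, h1, h2⟩ := exec_append.1 h
    have hle := card_le_card h1.uninformed_subset
    have h3 := ih (h1.good hg) (h1.pos_mono h0) h2
    rcases (uninformed σ).eq_empty_or_nonempty with hU | hU
    · rw [hU, card_empty] at hle ⊢
      omega
    · suffices (uninformed τ).card < (uninformed σ).card by omega
      obtain ⟨l₁, l₂, hl⟩ := List.append_of_mem
        (mem_toList.2 (mem_univ (uninformed σ)))
      rw [hl, List.map_append, List.map_cons] at h1
      obtain ⟨ρ, h4, ρ', h5, h6⟩ := exec_append.1 h1
      have l6 := card_le_card h6.uninformed_subset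
      have l5 := card_le_card h5.exec.uninformed_subset
      by_cases heq : uninformed ρ = uninformed σ
      · rw [← heq] at h5 hU ⊢
        have := toSet_progress hα1 hn (h4.good hg) (h4.pos_mono h0) hU h5
        omega
      · have := card_lt_card (h4.uninformed_subset.ssubset_of_ne heq)
        omega

theorem pos_ne_none_of_sweeps (hα1 : α < 1) (hn : 2 ≤ n) {σ : Config n}
    (h : Exec α (sweeps n n) (initial n) σ) (v : ZMod n) : (σ v).pos ≠ none := by
  have h3 := sweeps_progress hα1 hn good_initial (by rw [initial_zero]; simp) h
  have h5 : (uninformed (initial n)).card ≤ n := (card_le_univ _).trans (by rw [ZMod.card])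
  have h4 : (uninformed σ).card = 0 := by omega
  intro hv
  rw [card_eq_zero] at h4
  exact Finset.notMem_empty v (h4 ▸ mem_uninformed.2 hv)

end

/-! ### From the network to coordinates -/

lemma edgeConnectivity_top_le (hn : 2 ≤ n) :
    edgeConnectivity (⊤ : SimpleGraph (Fin n)) ≤ n - 1 := by
  have : Nontrivial (Fin n) := Fin.nontrivial_iff_two_le.2 hn
  refine csSup_le ⟨0, SimpleGraph.IsEdgeConnected.zero⟩ fun k hk => ?_
  have h := SimpleGraph.IsEdgeConnected.le_degree (u := (⟨0, by omega⟩ : Fin n)) hk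
  rwa [SimpleGraph.complete_graph_degree, Fintype.card_fin] at h

lemma faultBound_le {α β : ℝ} (hα : 0 ≤ α) (hαβ : α ≤ β) (hn : 2 ≤ n) (m : ℕ) :
    (Protocol.faultBound α (⊤ : SimpleGraph (Fin n)) m : ℝ) ≤ max ((n : ℝ) - 2) (β * m) := by
  unfold Protocol.faultBound
  rw [Nat.cast_max]
  apply max_le_max
  · have h := edgeConnectivity_top_le hn
    have h1 : edgeConnectivity (⊤ : SimpleGraph (Fin n)) - 1 + 2 ≤ n := by omega
    have h2 : ((edgeConnectivity (⊤ : SimpleGraph (Fin n)) - 1 : ℕ) : ℝ) + 2 ≤ n := by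
      exact_mod_cast h1
    linarith
  · calc ((⌊α * m⌋₊ : ℕ) : ℝ) ≤ α * m := Nat.floor_le (by positivity)
      _ ≤ β * m := by gcongr

section
variable (cyc : ZMod n ≃ Fin n) (s : Fin n)

/-- The vertex at clockwise distance `x` from the initiator. -/
def vertex : ZMod n ≃ Fin n := (Equiv.addRight (cyc.symm s)).trans cyc

lemma label_vertex (u v : ZMod n) :
    (chordalComplete cyc).label (vertex cyc s u) (vertex cyc s v) = v - u := by
  simp [chordalComplete, vertex]

lemma vertex_eq_iff (u : ZMod n) : vertex cyc s u = s ↔ u = 0 := by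
  simp [vertex, ← Equiv.eq_symm_apply]

variable (prog : List (Op n)) (lost : ℕ → Finset (Fin n × Fin n))

/-- The state of a vertex: the rest of the program, and the memory. -/
noncomputable def stateOf (t : ℕ) (v : Fin n) : List (Op n) × Reg n :=
  (protocol prog).state (chordalComplete cyc) s lost t v

/-- The message on an arc. -/
noncomputable def messageOf (t : ℕ) (u v : Fin n) : Option (Reg n) :=
  (protocol prog).message (chordalComplete cyc)
    ((protocol prog).state (chordalComplete cyc) s lost t) u v

/-- What a vertex receives. -/
def received (t : ℕ) (v : Fin n) : Set (ZMod n × Reg n) :=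
  {p | ∃ u, (u, v) ∉ lost t ∧ p.1 = (chordalComplete cyc).label v u ∧
    messageOf cyc s prog lost t u v = some p.2}

/-- The memories of all vertices, in coordinates. -/
noncomputable def config (t : ℕ) : Config n := fun x => (stateOf cyc s prog lost t (vertex cyc s x)).2

lemma stateOf_zero_initiator : stateOf cyc s prog lost 0 s = (prog, ⟨some 0, none, some 0, ∅, ∅⟩) :=
  if_pos rfl

lemma stateOf_zero_other {v : Fin n} (hv : v ≠ s) :
    stateOf cyc s prog lost 0 v = (prog, blank) :=
  if_neg hv

variable {cyc s prog lost}

lemma stateOf_succ_of_nil {t : ℕ} {v : Fin n} {r : Reg n}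
    (h : stateOf cyc s prog lost t v = ([], r)) : stateOf cyc s prog lost (t + 1) v = ([], r) := by
  have h1 : stateOf cyc s prog lost (t + 1) v
      = (protocol prog).receive (stateOf cyc s prog lost t v) (received cyc s prog lost t v) := rfl
  rw [h1, h]
  rfl

lemma stateOf_succ_of_cons {t : ℕ} {v : Fin n} {op : Op n} {l : List (Op n)} {r : Reg n}
    (h : stateOf cyc s prog lost t v = (op :: l, r)) :
    stateOf cyc s prog lost (t + 1) v = (l, next op r (received cyc s prog lost t v)) := by
  have h1 : stateOf cyc s prog lost (t + 1) v
      = (protocol prog).receive (stateOf cyc s prog lost t v) (received cyc s prog lost t v) := rfl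
  rw [h1, h]
  rfl

lemma messageOf_of_nil {t : ℕ} {u : Fin n} {r : Reg n}
    (h : stateOf cyc s prog lost t u = ([], r)) (v : Fin n) :
    messageOf cyc s prog lost t u v = none := by
  classical
  have h1 : messageOf cyc s prog lost t u v
      = if (chordalComplete cyc).graph.Adj u v then
          (protocol prog).send (stateOf cyc s prog lost t u) ((chordalComplete cyc).label u v)
        else none := by
    unfold messageOf Protocol.message
    congr
  rw [h1, h]
  exact ite_self none

open Classical in
lemma messageOf_of_cons {t : ℕ} {u : Fin n} {op : Op n} {l : List (Op n)} {r : Reg n}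
    (h : stateOf cyc s prog lost t u = (op :: l, r)) (v : Fin n) :
    messageOf cyc s prog lost t u v
      = if u ≠ v ∧ op.sends r ((chordalComplete cyc).label u v) then some r else none := by
  have h1 : messageOf cyc s prog lost t u v
      = if u ≠ v then
          (protocol prog).send (stateOf cyc s prog lost t u) ((chordalComplete cyc).label u v)
        else none := by
    unfold messageOf Protocol.message
    congr
  have h2 : (protocol prog).send (op :: l, r) ((chordalComplete cyc).label u v)
      = if op.sends r ((chordalComplete cyc).label u v) then some r else none := rfl
  rw [h1, h, h2, ite_and]
  congr

variable (cyc s prog lost)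

lemma stateOf_fst (t : ℕ) (v : Fin n) : (stateOf cyc s prog lost t v).1 = prog.drop t := by
  induction t with
  | zero =>
    by_cases hv : v = s
    · subst hv
      rw [stateOf_zero_initiator]
      rfl
    · rw [stateOf_zero_other _ _ _ _ hv]
      rfl
  | succ t ih =>
    rw [← List.tail_drop, ← ih]
    rcases hq : stateOf cyc s prog lost t v with ⟨_ | ⟨op, l⟩, r⟩
    · rw [stateOf_succ_of_nil hq]
      rfl
    · rw [stateOf_succ_of_cons hq]
      rfl

/-- Only the memory of the sender is ever sent. -/
lemma messageOf_eq_some {t : ℕ} {u v : Fin n} {m : Reg n}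
    (h : messageOf cyc s prog lost t u v = some m) : m = (stateOf cyc s prog lost t u).2 := by
  rcases hq : stateOf cyc s prog lost t u with ⟨_ | ⟨op, l⟩, r⟩
  · rw [messageOf_of_nil hq] at h
    cases h
  · rw [messageOf_of_cons hq] at h
    split_ifs at h
    exact (Option.some.inj h).symm

lemma messageOf_vertex {t : ℕ} {op : Op n} {l : List (Op n)} (ht : prog.drop t = op :: l)
    (u v : ZMod n) :
    messageOf cyc s prog lost t (vertex cyc s u) (vertex cyc s v) = open Classical in
      if u ≠ v ∧ op.sends (config cyc s prog lost t u) (v - u)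
      then some (config cyc s prog lost t u) else none := by
  have h : stateOf cyc s prog lost t (vertex cyc s u) = (op :: l, config cyc s prog lost t u) :=
    Prod.ext ((stateOf_fst ..).trans ht) rfl
  classical
  rw [messageOf_of_cons h, label_vertex]
  simp only [ne_eq, EmbeddingLike.apply_eq_iff_eq]

/-- A vertex whose memory says so has the information. -/
lemma mem_informed {t : ℕ} {v : Fin n} (h : (stateOf cyc s prog lost t v).2.pos ≠ none) :
    v ∈ (protocol prog).informed (chordalComplete cyc) s lost t := by
  induction t generalizing v with
  | zero =>
    by_contra hv
    rw [stateOf_zero_other _ _ _ _ hv] at h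
    exact h rfl
  | succ t ih =>
    by_cases hp : (stateOf cyc s prog lost t v).2.pos = none
    · rcases hq : stateOf cyc s prog lost t v with ⟨_ | ⟨op, l⟩, r⟩
      · rw [stateOf_succ_of_nil hq] at h
        rw [hq] at hp
        exact absurd hp h
      · rw [stateOf_succ_of_cons hq] at h
        rw [hq] at hp
        change r.pos = none at hp
        rw [next_pos, learn, hp, Option.none_or] at h
        obtain ⟨x, hx⟩ := Option.ne_none_iff_exists'.1 h
        obtain ⟨p, ⟨u, hu, -, hm⟩, z, hz, -⟩ := mem_of_pick hx
        refine Or.inr ⟨u, ih ?_, hu, ?_⟩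
        · rw [← messageOf_eq_some cyc s prog lost hm, hz]
          simp
        · change messageOf cyc s prog lost t u v ≠ none
          rw [hm]
          exact Option.some_ne_none _
    · exact Or.inl (ih hp)

lemma config_zero : config cyc s prog lost 0 = initial n := by
  funext x
  unfold config initial
  by_cases hx : x = 0
  · rw [(vertex_eq_iff cyc s x).2 hx, stateOf_zero_initiator, if_pos hx]
  · rw [stateOf_zero_other _ _ _ _ fun h => hx ((vertex_eq_iff cyc s x).1 h), if_neg hx]

variable [NeZero n]

lemma step_config {α β : ℝ} (hα : 0 ≤ α) (hαβ : α ≤ β) (hn : 2 ≤ n) {t : ℕ} {op : Op n}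
    {l : List (Op n)} (ht : prog.drop t = op :: l)
    (hlost : (lost t).card ≤ Protocol.faultBound α (chordalComplete cyc).graph
      ((protocol prog).sent (chordalComplete cyc) s lost t).card) :
    Step β op (config cyc s prog lost t) (config cyc s prog lost (t + 1)) := by
  classical
  set σ := config cyc s prog lost t with hσ
  set e := vertex cyc s with he
  have hsent : (protocol prog).sent (chordalComplete cyc) s lost t
      = (sent op σ).map (e.prodCongr e).toEmbedding := by
    ext ⟨a, b⟩
    obtain ⟨u, rfl⟩ := e.surjective a
    obtain ⟨v, rfl⟩ := e.surjective b
    have h1 : (e u, e v) ∈ (sent op σ).map (e.prodCongr e).toEmbedding ↔ (u, v) ∈ sent op σ :=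
      mem_map' (e.prodCongr e).toEmbedding (a := (u, v))
    have h2 : (e u, e v) ∈ (protocol prog).sent (chordalComplete cyc) s lost t
        ↔ messageOf cyc s prog lost t (e u) (e v) ≠ none :=
      mem_filter.trans (and_iff_right (mem_univ _))
    rw [h1, h2, mem_sent, messageOf_vertex cyc s prog lost ht, ← hσ]
    split_ifs with h3
    · exact iff_of_true (Option.some_ne_none _) h3
    · exact iff_of_false (fun h => h rfl) h3
  have hcard : ((protocol prog).sent (chordalComplete cyc) s lost t).card = (sent op σ).card := by
    rw [hsent, card_map]
  refine ⟨(sent op σ).filter fun a => (e a.1, e a.2) ∉ lost t, ⟨filter_subset _ _, ?_⟩, fun v => ?_⟩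
  · have h1 := card_filter_add_card_filter_not (s := sent op σ) fun a => (e a.1, e a.2) ∉ lost t
    have h2 : ((sent op σ).filter fun a => ¬ (e a.1, e a.2) ∉ lost t).card ≤ (lost t).card := by
      refine card_le_card_of_injOn (fun a => (e a.1, e a.2)) (fun a ha => ?_) fun a _ b _ hab => ?_
      · have := (mem_filter.1 ha).2
        simpa using this
      · exact (e.prodCongr e).injective hab
    have h3 := faultBound_le hα hαβ hn (sent op σ).card
    rw [hcard] at hlost
    have h4 : ((lost t).card : ℝ) ≤ _ := (Nat.cast_le.2 hlost).trans h3
    have h5 : (((sent op σ).filter fun a => (e a.1, e a.2) ∉ lost t).card : ℝ)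
        + ((sent op σ).filter fun a => ¬ (e a.1, e a.2) ∉ lost t).card = (sent op σ).card := by
      exact_mod_cast h1
    have h6 : (((sent op σ).filter fun a => ¬ (e a.1, e a.2) ∉ lost t).card : ℝ)
        ≤ (lost t).card := by exact_mod_cast h2
    linarith
  · have h1 : stateOf cyc s prog lost t (e v) = (op :: l, σ v) :=
      Prod.ext ((stateOf_fst ..).trans ht) rfl
    have h2 : config cyc s prog lost (t + 1) v = next op (σ v) (received cyc s prog lost t (e v)) :=
      congrArg Prod.snd (stateOf_succ_of_cons h1)
    rw [h2]
    congr 1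
    ext ⟨ℓ, m⟩
    constructor
    · rintro ⟨a, ha, hℓ, hm⟩
      obtain ⟨u, rfl⟩ := e.surjective a
      rw [label_vertex] at hℓ
      rw [messageOf_vertex cyc s prog lost ht, ← hσ] at hm
      split_ifs at hm with h3
      exact ⟨u, mem_filter.2 ⟨mem_sent.2 h3, ha⟩, Prod.ext hℓ (Option.some.inj hm).symm⟩
    · rintro ⟨u, hu, h3⟩
      obtain ⟨rfl, rfl⟩ := Prod.mk.inj h3
      obtain ⟨hu, hu'⟩ := mem_filter.1 hu
      refine ⟨e u, hu', (label_vertex cyc s v u).symm, ?_⟩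
      rw [messageOf_vertex cyc s prog lost ht, ← hσ, if_pos (mem_sent.1 hu)]

/-- A program broadcasts if all its executions in coordinates inform everybody. -/
theorem broadcastsWithin {α β : ℝ} (hα : 0 ≤ α) (hαβ : α ≤ β) (hn : 2 ≤ n)
    (h : ∀ σ, Exec β prog (initial n) σ → ∀ v, (σ v).pos ≠ none) :
    (protocol prog).BroadcastsWithin α (chordalComplete cyc) s prog.length := by
  intro lost hlost v
  have hexec : ∀ t ≤ prog.length, Exec β (prog.take t) (initial n) (config cyc s prog lost t) := by
    intro t
    induction t with
    | zero =>
      intro _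
      rw [config_zero]
      exact rfl
    | succ t ih =>
      intro ht
      rw [← List.take_append_getElem (by omega : t < prog.length)]
      exact exec_append.2 ⟨_, ih (by omega), (step_config cyc s prog lost hα hαβ hn
        (List.drop_eq_getElem_cons (by omega)) (hlost t (by omega)).2).exec⟩
  have h1 := hexec _ le_rfl
  rw [List.take_length] at h1
  refine mem_informed cyc s prog lost ?_
  have h2 := h _ h1 ((vertex cyc s).symm v)
  unfold config at h2
  rwa [Equiv.apply_symm_apply] at h2

end

/-! ### Running times -/

variable (n) in
lemma length_sweeps [NeZero n] (k : ℕ) : (sweeps n k).length = k * 2 ^ n := by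
  induction k with
  | zero => simp [sweeps]
  | succ k ih =>
    rw [sweeps, List.length_append, List.length_map, length_toList, ih, card_univ,
      Fintype.card_finset, ZMod.card]
    ring

/-- Logarithmically many rounds suffice to divide `n` by `n`. -/
lemma decay_pow_mul_le {δ : ℝ} (h0 : 0 < δ) (h1 : δ < 1) (hn : 2 ≤ n) :
    δ ^ ⌈Real.log n / -Real.log δ⌉₊ * n ≤ 1 := by
  have hn0 : (0 : ℝ) < n := by exact_mod_cast (by omega : 0 < n)
  have hlog : 0 < -Real.log δ := by linarith [Real.log_neg h0 h1]
  have h2 : Real.log n / -Real.log δ ≤ ⌈Real.log n / -Real.log δ⌉₊ := Nat.le_ceil _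
  rw [div_le_iff₀ hlog] at h2
  rw [← Real.log_nonpos_iff (by positivity), Real.log_mul (pow_pos h0 _).ne' hn0.ne', Real.log_pow]
  linarith

end ChordalBroadcast

open ChordalBroadcast in
theorem mainTheorem3 (α : ℝ) (hα0 : 0 < α) (hα1 : α < 1) :
    ∃ C : ℝ, ∀ n : ℕ, 2 ≤ n → ∃ T : ℕ, (T : ℝ) ≤ C * Real.log n ∧
      ∃ P : FaultyBroadcast.Protocol (ZMod n), ∀ (cyc : ZMod n ≃ Fin n) (s : Fin n),
        P.BroadcastsWithin α (FaultyBroadcast.chordalComplete cyc) s T := by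
  -- A larger fraction only helps the adversary.
  set β := max α (1 / 2) with hβ
  have hαβ : α ≤ β := le_max_left _ _
  have hβ2 : 1 / 2 ≤ β := le_max_right _ _
  have hβ1 : β < 1 := max_lt hα1 (by norm_num)
  obtain ⟨c, hc⟩ := exists_nat_ge (1 / (β * (1 - β) ^ 2))
  obtain ⟨n₀, hn₀⟩ := exists_nat_gt ((c * (c + 2) + 1) / (1 - β))
  have hδ0 := decay_pos hβ2 hβ1
  have hδ1 := decay_lt_one hβ2 hβ1
  set D : ℝ := -Real.log (decay β) with hD
  have hD0 : 0 < D := by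
    have := Real.log_neg hδ0 hδ1
    linarith
  have hlog2 : 0 < Real.log 2 := Real.log_pos (by norm_num)
  -- The length of the program for large networks is `A * R + B`.
  set A : ℝ := 2 + 2 * (c * (c + 3)) with hA
  set B : ℝ := 4 + 6 * (c * (c + 3)) + c with hB
  have hA0 : 0 < A := by positivity
  have hB0 : 0 < B := by positivity
  refine ⟨max (A / D + (A + B) / Real.log 2) (n₀ * 2 ^ n₀ / Real.log 2), fun n hn => ?_⟩
  have : NeZero n := ⟨by omega⟩
  have hlogn : Real.log 2 ≤ Real.log n :=
    Real.log_le_log (by norm_num) (by exact_mod_cast hn)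
  have hlogn0 : 0 < Real.log n := hlog2.trans_le hlogn
  by_cases hlarge : n₀ ≤ n
  · have hcn : (c : ℝ) * (c + 2) + 1 < (1 - β) * n := by
      have h1 : (n₀ : ℝ) ≤ n := by exact_mod_cast hlarge
      have h2 := hn₀.trans_le h1
      rw [div_lt_iff₀ (by linarith)] at h2
      linarith
    have hcn' : c + 2 ≤ n - 1 := by
      have h1 : (c : ℝ) * (c + 2) + 1 < n / 2 := by
        have : (0 : ℝ) ≤ n := by positivity
        nlinarith
      have h3 : c * (c + 2) * 2 + 2 < n := by
        have : (c : ℝ) * (c + 2) * 2 + 2 < n := by linarith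
        exact_mod_cast this
      have h4 : c + 3 ≤ n := by nlinarith
      omega
    obtain ⟨L, hL, hLc⟩ := Finset.exists_subset_card_eq (s := Finset.univ.erase (0 : ZMod n))
      (n := c + 2) (by rwa [Finset.card_erase_of_mem (Finset.mem_univ _), Finset.card_univ,
        ZMod.card])
    have hL0 : (0 : ZMod n) ∉ L := fun h => Finset.notMem_erase _ _ (hL h)
    set R := ⌈Real.log n / D⌉₊ with hR
    have hRdecay : decay β ^ R * n ≤ 1 := decay_pow_mul_le hδ0 hδ1 hn
    set prog : List (Op n) := spread (R + 2) ++ rescues (R + 2) L (c + 1) c with hprog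
    refine ⟨prog.length, ?_, protocol prog, fun cyc s =>
      broadcastsWithin cyc s prog hα0.le hαβ hn fun σ hσ v =>
        pos_ne_none_of_large hβ2 hβ1 hc hcn hRdecay hLc hL0 hσ v⟩
    have hlen : (prog.length : ℝ) = A * R + B := by
      rw [hprog, List.length_append, length_spread, length_rescues, hA, hB]
      push_cast
      ring
    have hRle : (R : ℝ) ≤ Real.log n / D + 1 := (Nat.ceil_lt_add_one (by positivity)).le
    rw [hlen]
    calc A * R + B ≤ A * (Real.log n / D + 1) + B := by gcongr
      _ = A / D * Real.log n + (A + B) / Real.log 2 * Real.log 2 := by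
          field_simp
          ring
      _ ≤ A / D * Real.log n + (A + B) / Real.log 2 * Real.log n := by gcongr
      _ = (A / D + (A + B) / Real.log 2) * Real.log n := by ring
      _ ≤ _ := by
          gcongr
          exact le_max_left _ _
  · refine ⟨(sweeps n n).length, ?_, protocol (sweeps n n), fun cyc s =>
      broadcastsWithin cyc s _ hα0.le hαβ hn fun σ hσ v =>
        pos_ne_none_of_sweeps hβ1 hn hσ v⟩
    rw [length_sweeps]
    push_cast
    have hle : n ≤ n₀ := by omega
    calc (n : ℝ) * 2 ^ n ≤ n₀ * 2 ^ n₀ := by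
          gcongr
          norm_num
      _ = n₀ * 2 ^ n₀ / Real.log 2 * Real.log 2 := by field_simp
      _ ≤ n₀ * 2 ^ n₀ / Real.log 2 * Real.log n := by gcongr
      _ ≤ _ := by
          gcongr
          exact le_max_right _ _
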